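/- Let $K$ be an algebraically closed field (of any characteristic), $n\ge 1$, $F=K((t))$, $A=K[[t]]$. *Setting.* Let $K^\infty=\{\sum_{j\ge N}a_je_j\mid N\in\mathbb Z,\ a_j\in K\}$ and $E_k=\{\sum_{j\ge k}a_je_j\}$. Let $\mathrm{Gr}_0(\infty)$ be the set of subspaces $V\subset K^\infty$ with $E_m\subset V\subset E_{-m}$ for some $m\in\mathbb N$ and virtual dimension $\dim(V/V\cap E_1)-\dim(E_1/V\cap E_1)=0$. Identify $K^\infty$ with $F^n$ through $e_{cn+i}\leftrightarrow t^ce_i$ ($1\le i\le n$, $c\in\mathbb Z$), and let $\widehat{\mathrm{Gr}}_0(n)\subset\mathrm{Gr}_0(\infty)$ be the subset of those $V$ which are $A$-lattices in $F^n$ (free $A$-submodules of rank $n$). Let $\mathcal I_0$ be the set of integer sequences $I=(i_1<i_2<\cdots)$ with $i_j=j$ for $j\gg0$, let $\wedge^\infty V_\infty$ be the space with basis $e_I=e_{i_1}\wedge e_{i_2}\wedge\cdots$, $I\in\mathcal I_0$, and let $p_I$ be the coordinate forms (infinite Plücker coordinates), so that the space $(\wedge^\infty V_\infty)^\star$ of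 linear forms, the degree-one part of the homogeneous coordinate ring of $\mathbb P(\wedge^\infty V_\infty)$, is the product $\prod_{I\in\mathcal I_0}K\,p_I$. $\mathrm{Gr}_0(\infty)$ is embedded in $\mathbb P(\wedge^\infty V_\infty)$ by $V\mapsto[v_1\wedge\cdots\wedge v_m\wedge e_{m+1}\wedge e_{m+2}\wedge\cdots]$, where $E_{m+1}\subset V$ and $v_1,\dots,v_m$ is a basis of $V$ modulo $E_{m+1}$. The degree-one part of the ideal of a subset is the space of linear forms vanishing at all its points. For a sequence $k=(k_1,k_2,\ldots)$ of integers that is a rearrangement of some $I\in\mathcal I_0$ moving only finitely many entries, let $p_k=\pm p_I$ with the sign of the rearrangement; put $p_k=0$ if $k$ has a repeated entry. For $I\in\mathcal I_0$ and $\ell\ge1$ the *shuffle* is $$\mathrm{sh}_{I,\ell}=\sum_{J\subset I,\ |J|=\ell}p_{I\setminus J\cup\widetilde J},$$ where $I\setminus J\cup\widetilde J$ denotes the sequence $I$ with each entry $i\in J$ replaced, in its position, by $i-n$; only finitely many summands are non-zero. **Theorem.** The shuffles generate the degree-one part of the ideal of the affine Grassmannian $\widehat{\mathrm{Gr}}_0(n)$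 inside the infinite Grassmannian $\mathrm{Gr}_0(\infty)$. Precisely: 1. No non-zero linear form vanishes on $\mathrm{Gr}_0(\infty)$ (so the degree-one part of its coordinate ring is all of $(\wedge^\infty V_\infty)^\star$). 2. Each $\omega\in\wedge^\infty V_\infty$ is annihilated by all but finitely many of the $\mathrm{sh}_{I,\ell}$ (so arbitrary families of coefficients $c_{I,\ell}$ give well-defined linear forms $\sum c_{I,\ell}\,\mathrm{sh}_{I,\ell}$), and a linear form on $\wedge^\infty V_\infty$ vanishes on $\widehat{\mathrm{Gr}}_0(n)$ if and only if it is of the form $\sum_{I\in\mathcal I_0,\ \ell\ge1}c_{I,\ell}\,\mathrm{sh}_{I,\ell}$ with $c_{I,\ell}\in K$. 3. A finite linear combination of infinite Plücker coordinates vanishes on $\widehat{\mathrm{Gr}}_0(n)$ if and only if it is a finite linear combination of shuffles. -/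

import Mathlib

open scoped LaurentSeries PowerSeries

noncomputable section

namespace AffGr

/-! ### The infinite Grassmannian

The space `K^∞ = {∑_{j ≥ N} a_j e_j}` is realised inside the space `ℤ → K` of all sequences
(`a j` is the coefficient of `e_j`), namely as the union of the subspaces `E_k`. -/

/-- `E_k`: the (infinite) linear combinations of the `e_j` with `j ≥ k`. -/
def E (K : Type*) [Field K] (k : ℤ) : Submodule K (ℤ → K) where
  carrier := {a | ∀ j, j < k → a j = 0}
  add_mem' := by
    intro a b ha hb j hj
    simp [ha j hj, hb j hj]
  zero_mem' := by
    intro j _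
    rfl
  smul_mem' := by
    intro c a ha j hj
    simp [ha j hj]

/-- `Gr(∞)`: the subspaces `V` with `E_m ⊆ V ⊆ E_{-m}` for some `m ∈ ℕ`. -/
def infGr (K : Type*) [Field K] : Set (Submodule K (ℤ → K)) :=
  {V | ∃ m : ℕ, E K m ≤ V ∧ V ≤ E K (-m)}

/-- The virtual dimension `dim (V / V ∩ E_1) - dim (E_1 / V ∩ E_1)`; both dimensions are finite
for `V` in `Gr(∞)`. -/
def vdim {K : Type*} [Field K] (V : Submodule K (ℤ → K)) : ℤ :=
  (Module.finrank K (V ⧸ (E K 1).submoduleOf V) : ℤ) -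
    (Module.finrank K (E K 1 ⧸ V.submoduleOf (E K 1)) : ℤ)

/-- `Gr_0(∞)`: the component of virtual dimension `0` of the infinite Grassmannian. -/
def infGr₀ (K : Type*) [Field K] : Set (Submodule K (ℤ → K)) :=
  {V | V ∈ infGr K ∧ vdim V = 0}

/-! ### The affine Grassmannian -/

/-- The `K⟦t⟧`-lattices in `F^n`, `F = K((t))`: the `K⟦t⟧`-submodules which are free of rank `n`. -/
def IsLattice {K : Type*} [Field K] {n : ℕ} (L : Submodule K⟦X⟧ (Fin n → K⸨X⸩)) : Prop :=
  Nonempty (Module.Basis (Fin n) K⟦X⟧ L)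

/-- The sequence `a` and the vector `x ∈ F^n` correspond to each other under the identification
`e_{cn+i} ↔ t^c e_i` for `1 ≤ i ≤ n` and `c ∈ ℤ` (the index `i : Fin n` below starts at `0`). -/
def Corresponds {K : Type*} [Field K] {n : ℕ} (a : ℤ → K) (x : Fin n → K⸨X⸩) : Prop :=
  ∀ (c : ℤ) (i : Fin n), a (c * n + ((i : ℕ) + 1 : ℕ)) = (x i).coeff c

/-- The component `Ĝr_0(n)` of the affine Grassmannian, embedded in `Gr_0(∞)`: the `V ∈ Gr_0(∞)`
which correspond to lattices in `F^n`. -/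
def affGr₀ (K : Type*) [Field K] (n : ℕ) : Set (Submodule K (ℤ → K)) :=
  {V | V ∈ infGr₀ K ∧ ∃ L : Submodule K⟦X⟧ (Fin n → K⸨X⸩), IsLattice L ∧
    ∀ a : ℤ → K, a ∈ V ↔ ∃ x ∈ L, Corresponds a x}

/-! ### Infinite wedges and Plücker coordinates -/

/-- `𝓘_0`: the almost natural sequences `i_1 < i_2 < ⋯` of integers of virtual cardinality `0`,
i.e. with `i_j = j` for all large `j`. The position `j : ℕ` below starts at `0`. -/
def Idx : Type :=
  {i : ℕ → ℤ // StrictMono i ∧ ∃ m : ℕ, ∀ j, m ≤ j → i j = j + 1}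

/-- The semi-infinite wedge space `Λ^∞ V_∞`, with its basis of infinite wedges
`e_I = e_{i_1} ∧ e_{i_2} ∧ ⋯`, `I ∈ 𝓘_0`. -/
abbrev Wedge (K : Type*) [Field K] : Type _ := Idx →₀ K

/-- The linear forms on `Λ^∞ V_∞`: the degree-one part of the homogeneous coordinate ring
of the projective ind-variety `ℙ(Λ^∞ V_∞)`. -/
abbrev LinForm (K : Type*) [Field K] : Type _ := Module.Dual K (Wedge K)

/-- The infinite Plücker coordinate `p_I`, the coordinate dual to `e_I = Finsupp.single I 1`. -/
def plucker (K : Type*) [Field K] (I : Idx) : LinForm K := Finsupp.lapply I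

/-- The columns `v_1, …, v_m` followed by `e_{m+1}, e_{m+2}, …` are a `ℤ × ℤ_+` matrix
presentation of `V`: `E_{m+1} ⊆ V` and `v_1, …, v_m` represent a basis of `V / E_{m+1}`. -/
def IsFrame {K : Type*} [Field K] (V : Submodule K (ℤ → K)) (m : ℕ) (v : Fin m → ℤ → K) : Prop :=
  V = Submodule.span K (Set.range v) ⊔ E K (m + 1) ∧
    LinearIndependent K (fun k => (E K (m + 1)).mkQ (v k))

open Classical in
/-- The coefficient of `e_I` in `v_1 ∧ ⋯ ∧ v_m ∧ e_{m+1} ∧ e_{m+2} ∧ ⋯`, for `v_1, …, v_m`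
linearly independent modulo `E_{m+1}`: the minor of the rows `i_1, …, i_m` if `i_j = j` for all
`j > m`, and `0` otherwise. -/
def minor {K : Type*} [Field K] (m : ℕ) (v : Fin m → ℤ → K) (I : Idx) : K :=
  if ∀ j, m ≤ j → I.1 j = j + 1 then
    (Matrix.of fun a b : Fin m => v b (I.1 a)).det
  else 0

/-- `ω` represents the image of `V ∈ Gr_0(∞)` in `ℙ(Λ^∞ V_∞)` under the Plücker embedding. -/
def IsPluckerVector {K : Type*} [Field K] (V : Submodule K (ℤ → K)) (ω : Wedge K) : Prop :=
  ∃ (m : ℕ) (v : Fin m → ℤ → K), IsFrame V m v ∧ ∀ I, ω I = minor m v I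

/-- The degree-one part of the homogeneous ideal of a set `S` of points of `Gr_0(∞)`: the linear
forms on `Λ^∞ V_∞` which vanish at every point of `S`. -/
def linearIdeal {K : Type*} [Field K] (S : Set (Submodule K (ℤ → K))) :
    Submodule K (LinForm K) where
  carrier := {f | ∀ V ∈ S, ∀ ω : Wedge K, IsPluckerVector V ω → f ω = 0}
  add_mem' := by
    intro f g hf hg V hV ω hω
    simp [hf V hV ω hω, hg V hV ω hω]
  zero_mem' := by
    intro V _ ω _
    rfl
  smul_mem' := by
    intro c f hf V hV ω hω
    simp [hf V hV ω hω]

/-! ### Shuffles -/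

open Classical in
/-- The alternating symbol `p_{k_1, k_2, …}` for a sequence `k` of integers which need not be
increasing: it is `0` if an entry is repeated, and the sign of the sorting permutation (given by
the number of inversions) times `p_I` if sorting `k` gives `I ∈ 𝓘_0`. -/
def pluckerSeq (K : Type*) [Field K] (k : ℕ → ℤ) : LinForm K :=
  Finsupp.linearCombination K fun I : Idx =>
    if Function.Injective k ∧ Set.range k = Set.range I.1 then
      (-1 : K) ^ {q : ℕ × ℕ | q.1 < q.2 ∧ k q.2 < k q.1}.ncard
    else 0

/-- The sequence `I` with the entries in the positions `J` replaced by the same entries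
minus `n`. -/
def lower (n : ℕ) (I : Idx) (J : Finset ℕ) : ℕ → ℤ :=
  fun j => if j ∈ J then I.1 j - n else I.1 j

/-- The shuffle `sh_{I,ℓ}`: the sum of all Plücker coordinates obtained by replacing `ℓ` elements
of `I` by the same elements minus `n`. Only finitely many summands are non-zero, as for all but
finitely many `J` an entry is repeated. -/
def shuffle (K : Type*) [Field K] (n : ℕ) (I : Idx) (ℓ : ℕ) : LinForm K :=
  ∑ᶠ J ∈ {J : Finset ℕ | J.card = ℓ}, pluckerSeq K (lower n I J)

end AffGr

end

/-! Coordinate subspaces have the basis vectors `e_I` as Plücker vectors, so no non-zero linear form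
vanishes on `infGr₀`. Give `e_I` the degree `∑ (j - i_j)`, the size of its partition. Then
`sh_{I,ℓ}` lives in degree `deg I + nℓ`, and only finitely many `I` have bounded degree; this gives
finiteness and reduces everything to one degree at a time.

Shuffles vanish: a lattice `V` is stable under `t`, which acts on `V / E_{M+1}` by a nilpotent
matrix `U`. If `A` consists of the rows `I` of a frame, lowering rows by `n` replaces them by rows
of `A U`, so `sh_{I,ℓ}` takes the value of the `X^ℓ`-coefficient of `det (A + X A U) = det A`.

Nothing else vanishes: let `u ^ n = t`, so that `u e_j = e_{j+1}`. Formally, `∏ (1 - x_i u⁻¹)⁻¹ E_1`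
has as coordinates the Schur polynomials `s_I(x)` in Jacobi-Trudi form, and `∏ (1 - x_i u⁻¹)` has
determinant `∏ (1 - x_i^n t⁻¹)` as a matrix over `t⁻¹`. This determinant becomes `1` in `R = K[x_1,
…, x_m] / (e_ℓ(x^n), ℓ ≥ 1)`. The `x_i` are nilpotent in `R`, so evaluation at `K`-points loses
information; but over `R[t⁻¹]` the matrix is a product of unitriangular ones and lifts, with
determinant `1`, to a polynomial ring surjecting onto `R`. Specialisations of the lift give genuine
lattices and `K` is infinite, so a form `f` vanishing on the lattices gives `∑ f_I s_I(x) ∈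
(e_ℓ(x^n))` (`sum_det_coeffZ_eq_zero`).

Multiplying by `x^δ`, antisymmetrizing and reading off coefficients (`straighten`) sends `s_I` to
`p_I` when `deg I = m`, and the ideal into the span of the shuffles: `e_ℓ(x^n)` times an alternant
is the sum of the alternants with `ℓ` exponents raised by `n`. With `m` variables this treats the
component of degree `m` (`component_mem_shuffleSpan`). No division occurs, so the characteristic is
irrelevant. -/

noncomputable section

namespace AffGr

open Finset

/-! ### Almost natural sequences -/

namespace Idx

/-- The sequence `I` satisfies `i_j = j` from position `M` on. -/
def Natural (I : Idx) (M : ℕ) : Prop := ∀ j, M ≤ j → I.1 j = j + 1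

theorem Natural.mono {I : Idx} {M N : ℕ} (h : I.Natural M) (hMN : M ≤ N) : I.Natural N :=
  fun j hj => h j (hMN.trans hj)

theorem exists_natural (I : Idx) : ∃ M, I.Natural M := I.2.2

theorem add_le (I : Idx) (j r : ℕ) : I.1 j + r ≤ I.1 (j + r) := by
  induction r with
  | zero => simp
  | succ r ih =>
    have := I.2.1 (show j + r < j + (r + 1) by omega)
    push_cast
    omega

theorem apply_le (I : Idx) (j : ℕ) : I.1 j ≤ j + 1 := by
  obtain ⟨M, hM⟩ := I.exists_natural
  have h1 := I.add_le j M
  have h2 := hM (j + M) (by omega)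
  push_cast at h2
  omega

theorem eq_of_range_eq {I K : Idx} (h : Set.range I.1 = Set.range K.1) : I = K :=
  Subtype.ext ((StrictMono.range_inj I.2.1 K.2.1).1 h)

/-- The degree of `e_I`: the size of the partition with parts `j - i_j`. -/
def deg (I : Idx) : ℕ := ∑ j ∈ range I.2.2.choose, ((j : ℤ) + 1 - I.1 j).toNat

theorem coe_deg {I : Idx} {M : ℕ} (h : I.Natural M) :
    (I.deg : ℤ) = ∑ j ∈ range M, ((j : ℤ) + 1 - I.1 j) := by
  have key : ∀ A B : ℕ, I.Natural A → A ≤ B →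
      ∑ j ∈ range A, ((j : ℤ) + 1 - I.1 j) = ∑ j ∈ range B, ((j : ℤ) + 1 - I.1 j) := by
    intro A B hA hAB
    refine sum_subset (range_mono hAB) fun j _ hj => ?_
    rw [hA j (by simpa using hj)]
    ring
  have h0 : I.Natural I.2.2.choose := I.2.2.choose_spec
  rw [key _ _ h (le_max_left M I.2.2.choose), ← key _ _ h0 (le_max_right _ _), deg]
  push_cast
  refine sum_congr rfl fun j _ => ?_
  have := I.apply_le j
  omega

/-- The parts `j + 1 - i_j` decrease weakly, so a non-zero part in position `j` forces `j + 1`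
non-zero parts, too many once `j ≥ deg I`. -/
theorem natural_deg (I : Idx) : I.Natural I.deg := by
  intro j hj
  by_contra hne
  obtain ⟨M, hM⟩ := I.exists_natural
  have hle : ∀ a ∈ range (j + 1), (1 : ℤ) ≤ (a : ℤ) + 1 - I.1 a := by
    intro a ha
    have h1 := I.add_le a (j - a)
    have h2 := I.apply_le j
    have h3 : a + (j - a) = j := by simp at ha; omega
    rw [h3] at h1
    have : (j : ℤ) = a + (j - a : ℕ) := by exact_mod_cast h3.symm
    omega
  have h1 := coe_deg (hM.mono (le_max_left M (j + 1)))
  have h2 : ∑ a ∈ range (j + 1), (1 : ℤ) ≤ ∑ a ∈ range (max M (j + 1)), ((a : ℤ) + 1 - I.1 a) :=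
    (sum_le_sum hle).trans (sum_le_sum_of_subset_of_nonneg (range_mono (le_max_right _ _))
      fun a _ _ => by have := I.apply_le a; omega)
  rw [← h1] at h2
  simp only [sum_const, card_range, nsmul_eq_mul, mul_one] at h2
  push_cast at h2
  omega

theorem sub_deg_le (I : Idx) (j : ℕ) : (j : ℤ) + 1 - I.deg ≤ I.1 j := by
  obtain ⟨M, hM⟩ := I.exists_natural
  have h1 := coe_deg (hM.mono (le_max_left M (j + 1)))
  have h2 := single_le_sum (f := fun a : ℕ => (a : ℤ) + 1 - I.1 a)
    (s := range (max M (j + 1))) (fun a _ => by have := I.apply_le a; omega)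
    (mem_range.2 (lt_of_lt_of_le (Nat.lt_succ_self j) (le_max_right M _)))
  rw [← h1] at h2
  change (j : ℤ) + 1 - I.1 j ≤ _ at h2
  omega

/-- The degree bounds both the length of the non-natural beginning and the depth of its entries, so
`I` is determined by `D` integers in `[-D, D]`. -/
theorem finite_deg_le (D : ℕ) : {I : Idx | I.deg ≤ D}.Finite := by
  refine Set.Finite.of_finite_image
    (f := fun (I : Idx) (a : Fin D) => I.1 a)
    ((Set.Finite.pi' (fun _ : Fin D => Set.finite_Icc (-(D : ℤ)) D)).subset ?_) ?_
  · rintro _ ⟨I, hI, rfl⟩ a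
    have h1 := I.apply_le a
    have h2 := I.sub_deg_le a
    have := a.2
    simp only [Set.mem_ofPred_eq] at hI
    simp only [Set.mem_Icc]
    omega
  · intro I hI K hK h
    refine Subtype.ext (funext fun j => ?_)
    by_cases hj : j < D
    · exact congrFun h ⟨j, hj⟩
    · have hD : D ≤ j := by omega
      rw [I.natural_deg.mono hI j hD, K.natural_deg.mono hK j hD]

theorem deg_le_of_le {I : Idx} {M B : ℕ} (h : I.Natural M) (hB : -(B : ℤ) ≤ I.1 0) :
    I.deg ≤ M * (B + 1) := by
  have h1 := coe_deg h
  have h2 : ∑ j ∈ range M, ((j : ℤ) + 1 - I.1 j) ≤ ∑ j ∈ range M, ((B : ℤ) + 1) := by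
    refine sum_le_sum fun j _ => ?_
    have := I.add_le 0 j
    rw [zero_add] at this
    omega
  rw [← h1] at h2
  simp at h2
  exact_mod_cast h2

end Idx

/-- The bound by `M` allows the sorted entries to be continued by `M + 1, M + 2, …`, so the virtual
cardinality is `0`. -/
theorem exists_sort {M : ℕ} {k : Fin M → ℤ} (hk : Function.Injective k) (hle : ∀ a, k a ≤ M) :
    ∃ I : Idx, I.Natural M ∧ ∃ σ : Equiv.Perm (Fin M), ∀ a, k a = I.1 (σ a) := by
  have hc : (univ.image k).card = M := by
    rw [card_image_of_injective _ hk, card_univ, Fintype.card_fin]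
  set s := univ.image k with hs
  let o := s.orderEmbOfFin hc
  have hmem : ∀ b, ∃ a, k a = o b := by
    intro b
    have h : o b ∈ s := s.orderEmbOfFin_mem hc b
    rw [hs, mem_image] at h
    obtain ⟨a, -, ha⟩ := h
    exact ⟨a, ha⟩
  have hole : ∀ b, o b ≤ M := fun b => by
    obtain ⟨a, ha⟩ := hmem b
    exact ha ▸ hle a
  let i : ℕ → ℤ := fun j => if h : j < M then o ⟨j, h⟩ else j + 1
  have hi : StrictMono i := by
    intro a b hab
    by_cases hb : b < M
    · have ha : a < M := hab.trans hb
      simp only [i, dif_pos ha, dif_pos hb]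
      exact o.strictMono (show (⟨a, ha⟩ : Fin M) < ⟨b, hb⟩ from hab)
    · by_cases ha : a < M
      · simp only [i, dif_pos ha, dif_neg hb]
        have := hole ⟨a, ha⟩
        omega
      · simp only [i, dif_neg ha, dif_neg hb]
        omega
  have hnat : ∀ j, M ≤ j → i j = j + 1 := fun j hj => by
    simp only [i, dif_neg (not_lt.2 hj)]
  refine ⟨⟨i, hi, M, hnat⟩, hnat, ?_⟩
  have hko : ∀ a, ∃ b, o b = k a := fun a => by
    have : k a ∈ Set.range o := by
      rw [Finset.range_orderEmbOfFin]
      simp [hs]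
    exact this
  choose σ hσ using hko
  have hσi : Function.Injective σ := fun a b h => hk (by rw [← hσ, ← hσ, h])
  refine ⟨Equiv.ofBijective σ (Finite.injective_iff_bijective.1 hσi), fun a => ?_⟩
  simp [i, hσ]

/-! ### The alternating symbols -/

variable {K : Type*} [Field K]

theorem neg_one_pow_inversions {M : ℕ} (σ : Equiv.Perm (Fin M)) :
    ((-1 : ℤ)) ^ #{q : Fin M × Fin M | q.1 < q.2 ∧ σ q.2 < σ q.1} =
      ((Equiv.Perm.sign σ : ℤˣ) : ℤ) := by
  have h1 : ((Equiv.Perm.sign σ : ℤˣ) : ℤ) =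
      ∏ q : Fin M × Fin M, if q.1 < q.2 ∧ σ q.2 < σ q.1 then (-1 : ℤ) else 1 := by
    rw [Equiv.Perm.sign_eq_prod_prod_Iio, Units.coe_prod, Fintype.prod_prod_type_right]
    refine prod_congr rfl fun b _ => ?_
    rw [Units.coe_prod, ← Finset.prod_subset (Finset.subset_univ (Iio b))]
    · refine prod_congr rfl fun a ha => ?_
      have hab : a < b := by simpa using ha
      have : σ a ≠ σ b := fun h => hab.ne (σ.injective h)
      by_cases h : σ a < σ b
      · simp [h, hab, h.le]
      · have h' : σ b < σ a := lt_of_le_of_ne (not_lt.1 h) this.symm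
        simp [h, hab, h']
    · intro a _ ha
      rw [if_neg]
      simp at ha
      exact fun h => absurd h.1 (not_lt.2 ha)
  rw [h1, prod_ite]
  simp

theorem pluckerSeq_single (k : ℕ → ℤ) (I : Idx) [Decidable (Function.Injective k ∧
    Set.range k = Set.range I.1)] :
    pluckerSeq K k (Finsupp.single I 1) =
      if Function.Injective k ∧ Set.range k = Set.range I.1 then
      (-1 : K) ^ {q : ℕ × ℕ | q.1 < q.2 ∧ k q.2 < k q.1}.ncard
    else 0 := by
  simp only [pluckerSeq, Finsupp.linearCombination_single, one_smul]
  congr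

theorem LinForm.ext {f g : LinForm K}
    (h : ∀ I : Idx, f (Finsupp.single I 1) = g (Finsupp.single I 1)) : f = g :=
  Finsupp.lhom_ext' fun I => LinearMap.ext_ring (h I)

theorem plucker_single (I J : Idx) [Decidable (I = J)] :
    plucker K I (Finsupp.single J 1) = if I = J then 1 else 0 := by
  classical
  simp [plucker, Finsupp.single_apply, eq_comm]

/-- The first `M` entries all lie below the natural tail, so no inversion involves a position beyond
`M` and the infinite inversion count is that of `σ`. -/
theorem pluckerSeq_of_perm {M : ℕ} {k : ℕ → ℤ} {I : Idx} (hk : ∀ j, M ≤ j → k j = j + 1)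
    (hI : I.Natural M) (σ : Equiv.Perm (Fin M)) (h : ∀ a : Fin M, k a = I.1 (σ a)) :
    pluckerSeq K k = (((Equiv.Perm.sign σ : ℤˣ) : ℤ) : K) • plucker K I := by
  classical
  have h' : ∀ (a : ℕ) (ha : a < M), k a = I.1 (σ ⟨a, ha⟩) := fun a ha => h ⟨a, ha⟩
  have hkI : ∀ j, M ≤ j → k j = I.1 j := fun j hj => by rw [hk j hj, hI j hj]
  have hinj : Function.Injective k := by
    intro a b hab
    by_cases ha : a < M <;> by_cases hb : b < M
    · rw [h' a ha, h' b hb] at hab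
      have := σ.injective (Fin.ext (I.2.1.injective hab))
      simpa using this
    · rw [h' a ha, hkI b (by omega)] at hab
      have := I.2.1.injective hab
      have := (σ ⟨a, ha⟩).2
      omega
    · rw [h' b hb, hkI a (by omega)] at hab
      have := I.2.1.injective hab
      have := (σ ⟨b, hb⟩).2
      omega
    · rw [hkI a (by omega), hkI b (by omega)] at hab
      exact I.2.1.injective hab
  have hrange : Set.range k = Set.range I.1 := by
    ext x
    constructor
    · rintro ⟨a, rfl⟩
      by_cases ha : a < M
      · exact ⟨_, (h' a ha).symm⟩
      · exact ⟨a, (hkI a (by omega)).symm⟩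
    · rintro ⟨a, rfl⟩
      by_cases ha : a < M
      · exact ⟨σ.symm ⟨a, ha⟩, by rw [h]; simp⟩
      · exact ⟨a, hkI a (by omega)⟩
  have hinv : {q : ℕ × ℕ | q.1 < q.2 ∧ k q.2 < k q.1} =
      (fun q : Fin M × Fin M => ((q.1 : ℕ), (q.2 : ℕ))) ''
        (({q : Fin M × Fin M | q.1 < q.2 ∧ σ q.2 < σ q.1} : Finset _) : Set _) := by
    ext ⟨a, b⟩
    simp only [Set.mem_ofPred_eq, coe_filter, mem_univ, true_and, Set.mem_image, Prod.mk.injEq,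
      Prod.exists]
    constructor
    · rintro ⟨hab, hlt⟩
      have hb : b < M := by
        by_contra hb
        rw [hkI b (by omega)] at hlt
        by_cases ha : a < M
        · rw [h' a ha] at hlt
          have := I.2.1.lt_iff_lt.1 hlt
          have := (σ ⟨a, ha⟩).2
          omega
        · rw [hkI a (by omega)] at hlt
          have := I.2.1.lt_iff_lt.1 hlt
          omega
      have ha : a < M := hab.trans hb
      refine ⟨⟨a, ha⟩, ⟨b, hb⟩, ⟨hab, ?_⟩, rfl, rfl⟩
      rw [h' a ha, h' b hb] at hlt
      exact I.2.1.lt_iff_lt.1 hlt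
    · rintro ⟨a, b, ⟨hab, hlt⟩, rfl, rfl⟩
      refine ⟨hab, ?_⟩
      rw [h, h]
      exact I.2.1 hlt
  have hcard : {q : ℕ × ℕ | q.1 < q.2 ∧ k q.2 < k q.1}.ncard =
      #{q : Fin M × Fin M | q.1 < q.2 ∧ σ q.2 < σ q.1} := by
    rw [hinv, Set.ncard_image_of_injective, Set.ncard_coe_finset]
    rintro ⟨a, b⟩ ⟨c, d⟩ hq
    simp only [Prod.mk.injEq] at hq
    exact Prod.ext (Fin.ext hq.1) (Fin.ext hq.2)
  refine LinForm.ext fun L => ?_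
  rw [pluckerSeq_single, LinearMap.smul_apply, plucker_single, hrange, hcard]
  by_cases hL : I = L
  · subst hL
    rw [if_pos ⟨hinj, rfl⟩, if_pos rfl, ← neg_one_pow_inversions]
    push_cast
    simp
  · rw [if_neg fun hh => hL (Idx.eq_of_range_eq hh.2), if_neg hL, smul_zero]

theorem pluckerSeq_eq_zero {k : ℕ → ℤ} (hk : ¬ Function.Injective k) : pluckerSeq K k = 0 := by
  classical
  refine LinForm.ext fun L => ?_
  rw [pluckerSeq_single, if_neg fun h => hk h.1]
  rfl

theorem range_eq_of_pluckerSeq_ne_zero {k : ℕ → ℤ} {L : Idx}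
    (h : pluckerSeq K k (Finsupp.single L 1) ≠ 0) :
    Function.Injective k ∧ Set.range k = Set.range L.1 := by
  classical
  rw [pluckerSeq_single] at h
  by_contra hc
  exact h (if_neg hc)

theorem exists_perm_of_range_eq {M : ℕ} {k : ℕ → ℤ} {L : Idx} (hk : ∀ j, M ≤ j → k j = j + 1)
    (hL : L.Natural M) (hinj : Function.Injective k) (hr : Set.range k = Set.range L.1) :
    ∃ σ : Equiv.Perm (Fin M), ∀ a : Fin M, k a = L.1 (σ a) := by
  have : ∀ a : Fin M, ∃ b : Fin M, L.1 b = k a := by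
    intro a
    obtain ⟨b, hb⟩ : k a ∈ Set.range L.1 := hr ▸ ⟨a, rfl⟩
    refine ⟨⟨b, ?_⟩, hb⟩
    by_contra hbM
    have h1 : k b = k a := by rw [← hb, hk b (by omega), hL b (by omega)]
    have := hinj h1
    have := a.2
    omega
  choose σ hσ using this
  have hσi : Function.Injective σ := fun a b hab =>
    Fin.ext (hinj (by rw [← hσ, ← hσ, hab]))
  exact ⟨Equiv.ofBijective σ (Finite.injective_iff_bijective.1 hσi), fun a => (hσ a).symm⟩

/-- At most one `σ` contributes. The sum is the form that matches a Leibniz expansion term by term,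
both for minors of unit vectors and for coefficients of alternants. -/
theorem pluckerSeq_single_eq_sum {M : ℕ} {k : ℕ → ℤ} {L : Idx} (hk : ∀ j, M ≤ j → k j = j + 1)
    (hL : L.Natural M) :
    pluckerSeq K k (Finsupp.single L 1) =
      ∑ σ : Equiv.Perm (Fin M), if ∀ a : Fin M, k a = L.1 (σ a) then
        (((Equiv.Perm.sign σ : ℤˣ) : ℤ) : K) else 0 := by
  classical
  by_cases h : ∃ σ : Equiv.Perm (Fin M), ∀ a : Fin M, k a = L.1 (σ a)
  · obtain ⟨σ, hσ⟩ := h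
    rw [pluckerSeq_of_perm hk hL σ hσ, Finset.sum_eq_single σ]
    · rw [if_pos hσ, LinearMap.smul_apply, plucker_single, if_pos rfl, smul_eq_mul, mul_one]
    · intro τ _ hτ
      refine if_neg fun hh => hτ (Equiv.ext fun a => ?_)
      exact Fin.ext (L.2.1.injective ((hh a).symm.trans (hσ a)))
    · simp
  · rw [Finset.sum_eq_zero fun σ _ => if_neg fun hσ => h ⟨σ, hσ⟩]
    by_contra hne
    obtain ⟨h1, h2⟩ := range_eq_of_pluckerSeq_ne_zero hne
    exact h (exists_perm_of_range_eq hk hL h1 h2)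

/-! ### Shuffles -/

theorem lower_natural {n M : ℕ} {I : Idx} {J : Finset ℕ} (hI : I.Natural M) (hJ : J ⊆ range M)
    (j : ℕ) (hj : M ≤ j) : lower n I J j = j + 1 := by
  have : j ∉ J := fun h => by
    have := mem_range.1 (hJ h)
    omega
  rw [lower, if_neg this, hI j hj]

theorem sum_lower {n M : ℕ} {I : Idx} {J : Finset ℕ} (hJ : J ⊆ range M) :
    ∑ j ∈ range M, lower n I J j = ∑ j ∈ range M, I.1 j - J.card * n := by
  have : ∀ j, lower n I J j = I.1 j - if j ∈ J then (n : ℤ) else 0 := fun j => by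
    rw [lower]
    split_ifs <;> simp
  simp_rw [this]
  rw [sum_sub_distrib, ← sum_filter, filter_mem_eq_inter, inter_eq_right.2 hJ]
  simp

/-- A lowered sequence involves `e_L` only if the degrees match. -/
theorem deg_eq_of_pluckerSeq_lower {n : ℕ} {I L : Idx} {J : Finset ℕ}
    (h : pluckerSeq K (lower n I J) (Finsupp.single L 1) ≠ 0) : L.deg = I.deg + n * J.card := by
  obtain ⟨M₁, h₁⟩ := I.exists_natural
  obtain ⟨M₂, h₂⟩ := L.exists_natural
  obtain ⟨M₃, h₃⟩ : ∃ M, J ⊆ range M := J.exists_nat_subset_range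
  set M := max M₁ (max M₂ M₃)
  have hI : I.Natural M := h₁.mono (by omega)
  have hL : L.Natural M := h₂.mono (by omega)
  have hJ : J ⊆ range M := h₃.trans (range_mono (by omega))
  obtain ⟨hinj, hr⟩ := range_eq_of_pluckerSeq_ne_zero h
  obtain ⟨σ, hσ⟩ := exists_perm_of_range_eq (lower_natural hI hJ) hL hinj hr
  have hs : ∑ j ∈ range M, lower n I J j = ∑ j ∈ range M, L.1 j := by
    rw [Finset.sum_range, Finset.sum_range, ← Equiv.sum_comp σ (fun a : Fin M => L.1 a)]
    exact Finset.sum_congr rfl fun a _ => hσ a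
  have e1 := Idx.coe_deg hI
  have e2 := Idx.coe_deg hL
  rw [sum_sub_distrib] at e1 e2
  rw [sum_lower hJ] at hs
  have : (L.deg : ℤ) = I.deg + n * J.card := by rw [e1, e2, ← hs]; ring
  exact_mod_cast this

theorem subset_range_of_pluckerSeq_lower {n M : ℕ} (hn : 1 ≤ n) {I L : Idx} {J : Finset ℕ}
    (hI : I.Natural M) (hL : L.Natural M)
    (h : pluckerSeq K (lower n I J) (Finsupp.single L 1) ≠ 0) : J ⊆ range M := by
  obtain ⟨hinj, hr⟩ := range_eq_of_pluckerSeq_ne_zero h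
  by_contra hJ
  obtain ⟨a₀, ha₀, ha₀M⟩ := Finset.not_subset.1 hJ
  have hne : J.Nonempty := ⟨a₀, ha₀⟩
  -- The value `a + 1` is an entry of `L` but is lost by lowering: lowered entries sit at positions
  -- `≤ a` and drop below it, and an unlowered entry `a + 1` could only sit at position `a`, which
  -- lies in `J`.
  set a := J.max' hne
  have haJ : a ∈ J := J.max'_mem hne
  have haM : M ≤ a := by
    have := J.le_max' a₀ ha₀
    simp at ha₀M
    omega
  obtain ⟨b, hb⟩ : L.1 a ∈ Set.range (lower n I J) := hr ▸ ⟨a, rfl⟩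
  rw [hL a haM] at hb
  by_cases hbJ : b ∈ J
  · rw [lower, if_pos hbJ] at hb
    have h1 : b ≤ a := J.le_max' b hbJ
    have h2 : I.1 b ≤ b + 1 := I.apply_le b
    omega
  · rw [lower, if_neg hbJ, ← hI a haM] at hb
    exact hbJ (I.2.1.injective hb ▸ haJ)

/-- Every `L` that occurs has degree `deg I + nℓ`, so both `I` and `L` are natural from `N` on,
which confines `J` to positions below `N`. -/
theorem shuffle_eq_sum {n : ℕ} (hn : 1 ≤ n) (I : Idx) (ℓ : ℕ) {N : ℕ}
    (hN : I.deg + n * ℓ ≤ N) :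
    shuffle K n I ℓ = ∑ J ∈ powersetCard ℓ (range N), pluckerSeq K (lower n I J) := by
  classical
  rw [shuffle, finsum_mem_eq_sum_of_inter_support_eq]
  ext J
  simp only [Set.mem_inter_iff, Set.mem_ofPred_eq, Function.mem_support, mem_coe,
    mem_powersetCard]
  constructor
  · rintro ⟨hJ, h⟩
    refine ⟨⟨?_, hJ⟩, h⟩
    obtain ⟨L, hL⟩ : ∃ L, pluckerSeq K (lower n I J) (Finsupp.single L 1) ≠ 0 := by
      by_contra! hc
      exact h (LinForm.ext fun L => by rw [hc]; rfl)
    have hdeg := deg_eq_of_pluckerSeq_lower hL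
    rw [hJ] at hdeg
    exact subset_range_of_pluckerSeq_lower hn (I.natural_deg.mono (by omega))
      (L.natural_deg.mono (by omega)) hL
  · rintro ⟨⟨_, hJ⟩, h⟩
    exact ⟨hJ, h⟩

theorem shuffle_single {n : ℕ} (hn : 1 ≤ n) {I L : Idx} (ℓ : ℕ) {N : ℕ} (hI : I.Natural N)
    (hL : L.Natural N) :
    shuffle K n I ℓ (Finsupp.single L 1) =
      ∑ J ∈ powersetCard ℓ (range N), pluckerSeq K (lower n I J) (Finsupp.single L 1) := by
  rw [shuffle_eq_sum hn I ℓ (le_max_left _ N), LinearMap.sum_apply]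
  symm
  refine sum_subset (powersetCard_mono (range_mono (le_max_right _ _))) fun J hJ hJN => ?_
  by_contra hne
  exact hJN (mem_powersetCard.2 ⟨subset_range_of_pluckerSeq_lower hn hI hL hne,
    (mem_powersetCard.1 hJ).2⟩)

theorem deg_eq_of_shuffle {n : ℕ} (hn : 1 ≤ n) {I L : Idx} {ℓ : ℕ}
    (h : shuffle K n I ℓ (Finsupp.single L 1) ≠ 0) : L.deg = I.deg + n * ℓ := by
  rw [shuffle_eq_sum hn I ℓ le_rfl, LinearMap.sum_apply] at h
  obtain ⟨J, hJ, hne⟩ := exists_ne_zero_of_sum_ne_zero h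
  rw [deg_eq_of_pluckerSeq_lower hne, (mem_powersetCard.1 hJ).2]

theorem finite_deg_add_le {n : ℕ} (hn : 1 ≤ n) (D : ℕ) :
    {q : Idx × ℕ+ | q.1.deg + n * (q.2 : ℕ) ≤ D}.Finite := by
  have h2 : {ℓ : ℕ+ | (ℓ : ℕ) ≤ D}.Finite :=
    Set.Finite.of_finite_image (f := ((↑) : ℕ+ → ℕ))
      ((Set.finite_Iic D).subset (by rintro _ ⟨ℓ, hℓ, rfl⟩; exact hℓ))
      PNat.coe_injective.injOn
  refine ((Idx.finite_deg_le D).prod h2).subset ?_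
  rintro ⟨I, ℓ⟩ hq
  simp only [Set.mem_ofPred_eq, Set.mem_prod] at hq ⊢
  have := Nat.le_mul_of_pos_left (ℓ : ℕ) hn
  exact ⟨by omega, by omega⟩

theorem finite_shuffle_ne_zero {n : ℕ} (hn : 1 ≤ n) (ω : Wedge K) :
    {q : Idx × ℕ+ | shuffle K n q.1 q.2 ω ≠ 0}.Finite := by
  refine (finite_deg_add_le hn (ω.support.sup Idx.deg)).subset ?_
  rintro ⟨I, ℓ⟩ hq
  simp only [Set.mem_ofPred_eq] at hq ⊢
  rw [← ω.sum_single, Finsupp.sum, map_sum] at hq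
  obtain ⟨L, hL, hne⟩ := exists_ne_zero_of_sum_ne_zero hq
  rw [← mul_one (ω L), ← smul_eq_mul, ← Finsupp.smul_single, map_smul] at hne
  rw [← deg_eq_of_shuffle hn (right_ne_zero_of_smul hne)]
  exact le_sup (f := Idx.deg) hL

end AffGr

end

noncomputable section

namespace AffGr

open Finset

/-! ### Frames -/

variable {K : Type*} [Field K]

theorem E_anti {k l : ℤ} (h : k ≤ l) : E K l ≤ E K k := fun _ ha j hj => ha j (hj.trans_le h)

theorem E_eq_span_sup (k : ℤ) :
    E K k = Submodule.span K {(Pi.single k 1 : ℤ → K)} ⊔ E K (k + 1) := by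
  apply le_antisymm
  · intro a ha
    have : a = a k • (Pi.single k 1 : ℤ → K) + (a - a k • (Pi.single k 1 : ℤ → K)) := by abel
    rw [this]
    refine Submodule.add_mem_sup (Submodule.smul_mem _ _ (Submodule.mem_span_singleton_self _)) ?_
    intro j hj
    rcases (Int.lt_add_one_iff.1 hj).lt_or_eq with h | rfl
    · simp [ha j h, h.ne]
    · simp
  · refine sup_le ?_ (E_anti (by omega))
    rw [Submodule.span_singleton_le_iff_mem]
    intro j hj
    simp [hj.ne]

theorem linearIndependent_mkQ_iff {m : ℕ} {W : Submodule K (ℤ → K)} {v : Fin m → ℤ → K} :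
    LinearIndependent K (fun k => W.mkQ (v k)) ↔
      ∀ c : Fin m → K, ∑ k, c k • v k ∈ W → c = 0 := by
  rw [Fintype.linearIndependent_iff]
  have : ∀ c : Fin m → K, ∑ k, c k • W.mkQ (v k) = 0 ↔ ∑ k, c k • v k ∈ W := by
    intro c
    rw [← Submodule.Quotient.mk_eq_zero, ← Submodule.mkQ_apply, map_sum]
    simp only [map_smul]
  simp_rw [this, funext_iff]
  rfl

theorem IsFrame.snoc {V : Submodule K (ℤ → K)} {m : ℕ} {v : Fin m → ℤ → K} (h : IsFrame V m v) :
    IsFrame V (m + 1) (Fin.snoc v (Pi.single ((m : ℤ) + 1) 1) : Fin (m + 1) → ℤ → K) := by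
  obtain ⟨h1, h2⟩ := h
  refine ⟨?_, ?_⟩
  · have hr : Set.range (Fin.snoc v (Pi.single ((m : ℤ) + 1) 1) : Fin (m + 1) → ℤ → K) =
        Set.range v ∪ {Pi.single ((m : ℤ) + 1) 1} := by
      ext x
      simp [eq_comm]
    rw [hr, Submodule.span_union, sup_assoc]
    push_cast
    rw [← E_eq_span_sup, ← h1]
  · rw [linearIndependent_mkQ_iff] at h2 ⊢
    intro c hc
    rw [Fin.sum_univ_castSucc] at hc
    simp only [Fin.snoc_castSucc, Fin.snoc_last] at hc
    push_cast at hc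
    have hc0 : (fun k : Fin m => c k.castSucc) = 0 := by
      apply h2
      intro j hj
      have := hc j (by omega)
      simpa [hj.ne] using this
    have hlast : c (Fin.last m) = 0 := by
      have := hc (m + 1) (by omega)
      have h0 : ∀ k : Fin m, c k.castSucc = 0 := fun k => congrFun hc0 k
      simpa [h0] using this
    funext k
    refine Fin.lastCases hlast (fun k => congrFun hc0 k) k

theorem det_eq_of_last_column {R : Type*} [CommRing R] {m : ℕ}
    (A : Matrix (Fin (m + 1)) (Fin (m + 1)) R) (h0 : ∀ a : Fin m, A a.castSucc (Fin.last m) = 0)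
    (h1 : A (Fin.last m) (Fin.last m) = 1) :
    A.det = (A.submatrix Fin.castSucc Fin.castSucc).det := by
  rw [Matrix.det_succ_column A (Fin.last m), Fin.sum_univ_castSucc]
  simp [h0, h1, ← two_mul]

/-- The new column is `e_{m+1}`. If `I` is natural beyond `m`, it meets only the last row; if `I` is
natural only beyond `m + 1`, it meets no row. Hence frames can be lengthened without changing the
Plücker vector. -/
theorem minor_snoc {m : ℕ} (v : Fin m → ℤ → K) (I : Idx) :
    minor (m + 1) (Fin.snoc v (Pi.single ((m : ℤ) + 1) 1) : Fin (m + 1) → ℤ → K) I =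
      minor m v I := by
  unfold minor
  by_cases h : ∀ j, m ≤ j → I.1 j = j + 1
  · rw [if_pos h, if_pos fun j hj => h j (by omega), det_eq_of_last_column]
    · congr 1
      ext a b
      simp
    · intro a
      have := I.2.1 a.2
      rw [h m le_rfl] at this
      simp [this.ne]
    · simp [h m le_rfl]
  · rw [if_neg h]
    split_ifs with h'
    · apply Matrix.det_eq_zero_of_column_eq_zero (Fin.last m)
      intro a
      have hm : I.1 m ≠ m + 1 := fun hm => h fun j hj => by
        rcases hj.eq_or_lt with rfl | hj
        · exact hm
        · exact h' j hj
      have hne : I.1 a ≠ (m : ℤ) + 1 := by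
        intro ha
        have h3 : I.1 a ≤ I.1 m := I.2.1.monotone (Fin.is_le a)
        have := I.apply_le m
        omega
      simp [hne]
    · rfl

theorem IsFrame.exists_of_le {V : Submodule K (ℤ → K)} {m : ℕ} {v : Fin m → ℤ → K}
    (h : IsFrame V m v) {M : ℕ} (hM : m ≤ M) :
    ∃ w : Fin M → ℤ → K, IsFrame V M w ∧ ∀ I, minor M w I = minor m v I := by
  induction M, hM using Nat.le_induction with
  | base => exact ⟨v, h, fun _ => rfl⟩
  | succ M hM ih =>
    obtain ⟨w, hw, hm⟩ := ih
    exact ⟨_, hw.snoc, fun I => by rw [minor_snoc, hm]⟩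

/-! ### Frames of unit vectors and the virtual dimension -/

theorem single_frame_linearIndependent {m : ℕ} {k : Fin m → ℤ} (hk : Function.Injective k)
    (hle : ∀ a, k a ≤ m) :
    LinearIndependent K fun a => (E K (m + 1)).mkQ (Pi.single (k a) 1) := by
  rw [linearIndependent_mkQ_iff]
  intro c hc
  funext a
  have := hc (k a) (by have := hle a; omega)
  simpa [Pi.single_apply, hk.eq_iff] using this

theorem E_one_isFrame (m : ℕ) :
    IsFrame (E K 1) m (fun a => (Pi.single ((a : ℤ) + 1) 1 : ℤ → K)) := by
  refine ⟨?_, single_frame_linearIndependent (fun a b h => Fin.ext (by simpa using h))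
    fun a => by have := a.2; omega⟩
  induction m with
  | zero => simp
  | succ m ih =>
    rw [ih, E_eq_span_sup (m + 1 : ℤ), ← sup_assoc, ← Submodule.span_union]
    push_cast
    congr 2
    ext x
    simp [Fin.exists_fin_succ', eq_comm, or_comm]

/-- Rank-nullity for `X / W → X / B` restricted to the image of `A`. The intersection term is
symmetric in `A` and `B`, so it cancels in the virtual dimension. -/
theorem finrank_quotient_add_finrank_inf {X : Type*} [AddCommGroup X] [Module K X]
    {A B W : Submodule K X} (hW : W ≤ B) [FiniteDimensional K (A.map W.mkQ)] :
    Module.finrank K (A ⧸ B.submoduleOf A) +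
      Module.finrank K (A.map W.mkQ ⊓ B.map W.mkQ : Submodule K (X ⧸ W)) =
      Module.finrank K (A.map W.mkQ) := by
  let φ : A.map W.mkQ →ₗ[K] X ⧸ B := (Submodule.factor hW).domRestrict (A.map W.mkQ)
  have hr : LinearMap.range φ = LinearMap.range (B.mkQ.comp A.subtype) := by
    rw [LinearMap.range_domRestrict, ← Submodule.map_comp, LinearMap.range_comp,
      Submodule.range_subtype]
    rfl
  have hk : LinearMap.ker (B.mkQ.comp A.subtype) = B.submoduleOf A := by
    rw [LinearMap.ker_comp, Submodule.ker_mkQ]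
    rfl
  have hkφ : LinearMap.ker φ =
      (A.map W.mkQ ⊓ B.map W.mkQ).submoduleOf (A.map W.mkQ) := by
    have : LinearMap.ker (Submodule.factor hW) = B.map W.mkQ := by
      ext x
      obtain ⟨x, rfl⟩ := W.mkQ_surjective x
      have : Submodule.factor hW (W.mkQ x) = Submodule.Quotient.mk x := rfl
      rw [LinearMap.mem_ker, this, Submodule.Quotient.mk_eq_zero, Submodule.mem_map]
      constructor
      · intro hx
        exact ⟨x, hx, rfl⟩
      · rintro ⟨y, hy, hxy⟩
        have := (Submodule.Quotient.eq W).1 hxy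
        have h2 := B.sub_mem hy (hW this)
        simpa using h2
    ext ⟨x, hx⟩
    have := congrArg (x ∈ ·) this
    simp only [LinearMap.mem_ker, eq_iff_iff] at this
    simp only [φ, LinearMap.mem_ker, LinearMap.domRestrict_apply, this, Submodule.submoduleOf,
      Submodule.mem_comap, Submodule.subtype_apply, Submodule.mem_inf, hx, true_and]
  have h1 := LinearMap.finrank_range_add_finrank_ker φ
  rw [hr, hkφ] at h1
  rw [← h1]
  congr 1
  · rw [← hk]
    exact (LinearMap.quotKerEquivRange _).finrank_eq
  · exact ((Submodule.submoduleOfEquivOfLe inf_le_left).finrank_eq).symm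

theorem IsFrame.map_mkQ {V : Submodule K (ℤ → K)} {m : ℕ} {v : Fin m → ℤ → K}
    (h : IsFrame V m v) : FiniteDimensional K (V.map (E K (m + 1)).mkQ) ∧
      Module.finrank K (V.map (E K (m + 1)).mkQ) = m := by
  have : V.map (E K (m + 1)).mkQ =
      Submodule.span K (Set.range fun k => (E K (m + 1)).mkQ (v k)) := by
    rw [h.1, Submodule.map_sup, Submodule.map_span, ← Set.range_comp]
    have : (E K (m + 1)).map (E K (m + 1)).mkQ = ⊥ := by
      rw [Submodule.mkQ_map_self]
    rw [this, sup_bot_eq]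
    rfl
  rw [this]
  refine ⟨FiniteDimensional.span_of_finite K (Set.finite_range _), ?_⟩
  rw [finrank_span_eq_card h.2, Fintype.card_fin]

/-- Modulo `E_{m+1}` both `V` and `E_1` have dimension `m`, so their codimensions over the
intersection agree. -/
theorem IsFrame.mem_infGr₀ {V : Submodule K (ℤ → K)} {m : ℕ} {v : Fin m → ℤ → K}
    (h : IsFrame V m v) {B : ℕ} (hB : V ≤ E K (-B)) : V ∈ infGr₀ K := by
  have hle : E K (m + 1) ≤ V := h.1 ▸ le_sup_right
  refine ⟨⟨max (m + 1) B, (E_anti ?_).trans hle, hB.trans (E_anti ?_)⟩, ?_⟩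
  · push_cast
    exact le_max_left _ _
  · push_cast
    have := le_max_right ((m : ℤ) + 1) (B : ℤ)
    omega
  · obtain ⟨hf, hr⟩ := h.map_mkQ
    obtain ⟨hf', hr'⟩ := (E_one_isFrame (K := K) m).map_mkQ
    have e1 := finrank_quotient_add_finrank_inf (A := V) (B := E K 1)
      (E_anti (K := K) (show (1 : ℤ) ≤ m + 1 by omega))
    have e2 := finrank_quotient_add_finrank_inf (A := E K 1) (B := V) hle
    rw [inf_comm] at e2
    rw [vdim]
    omega

/-! ### Coordinate subspaces -/

theorem det_single_eq_pluckerSeq {M : ℕ} {k : ℕ → ℤ} {L : Idx} (hk : ∀ j, M ≤ j → k j = j + 1)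
    (hL : L.Natural M) :
    (Matrix.of fun a b : Fin M => (Pi.single (k b) 1 : ℤ → K) (L.1 a)).det =
      pluckerSeq K k (Finsupp.single L 1) := by
  classical
  rw [pluckerSeq_single_eq_sum hk hL, Matrix.det_apply']
  refine sum_congr rfl fun σ _ => ?_
  simp only [Matrix.of_apply, Pi.single_apply]
  rw [Finset.prod_ite_zero]
  simp [eq_comm]

theorem linearIdeal_infGr₀ : linearIdeal (infGr₀ K) = ⊥ := by
  classical
  rw [eq_bot_iff]
  intro f hf
  refine LinForm.ext fun I => ?_
  obtain ⟨M, hM⟩ := I.exists_natural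
  let v : Fin M → ℤ → K := fun b => Pi.single (I.1 b) 1
  have hv : IsFrame (Submodule.span K (Set.range v) ⊔ E K (M + 1)) M v :=
    ⟨rfl, single_frame_linearIndependent (fun a b h => Fin.ext (I.2.1.injective h))
      fun a => (I.apply_le a).trans (by have := a.2; omega)⟩
  refine hf _ (hv.mem_infGr₀ (B := (I.1 0).natAbs) (sup_le ?_ (E_anti (by omega)))) _
    ⟨M, v, hv, fun L => ?_⟩
  · rw [Submodule.span_le]
    rintro _ ⟨b, rfl⟩ j hj
    have h1 : I.1 0 ≤ I.1 b := I.2.1.monotone (Nat.zero_le _)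
    have : j ≠ I.1 b := by omega
    simp [v, this]
  · rw [minor]
    split_ifs with hL
    · rw [det_single_eq_pluckerSeq hM hL, pluckerSeq_of_perm hM hM 1 fun _ => rfl]
      simp [plucker, Finsupp.single_apply, eq_comm]
    · have : I ≠ L := fun h => hL (h ▸ hM)
      simp [this]

end AffGr

end

noncomputable section

namespace AffGr

open Finset

/-! ### The shuffles vanish on the affine Grassmannian -/

variable {K : Type*} [Field K]

theorem sum_powersetCard_range {M : ℕ} (ℓ : ℕ) {β : Type*} [AddCommMonoid β]
    (g : Finset ℕ → β) :
    ∑ J ∈ powersetCard ℓ (range M), g J =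
      ∑ s ∈ powersetCard ℓ (univ : Finset (Fin M)), g (s.map Fin.valEmbedding) := by
  have : range M = univ.map (Fin.valEmbedding (n := M)) := by
    ext x
    simp
  rw [this, powersetCard_map, sum_map]
  rfl

/-- Sorting the entries permutes the rows and produces the same sign; a repeated entry gives two
equal rows. -/
theorem pluckerSeq_apply_eq_det {M : ℕ} {k : ℕ → ℤ} (hk : ∀ j, M ≤ j → k j = j + 1)
    (hle : ∀ a : Fin M, k a ≤ M) {v : Fin M → ℤ → K} {ω : Wedge K} (hω : ∀ I, ω I = minor M v I) :
    pluckerSeq K k ω = (Matrix.of fun a b : Fin M => v b (k a)).det := by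
  by_cases hinj : Function.Injective fun a : Fin M => k a
  · obtain ⟨I, hI, σ, hσ⟩ := exists_sort hinj hle
    rw [pluckerSeq_of_perm hk hI σ hσ, LinearMap.smul_apply, plucker, Finsupp.lapply_apply, hω,
      minor, if_pos (show ∀ j, M ≤ j → I.1 j = j + 1 from hI), smul_eq_mul, ← Matrix.det_permute]
    congr 1
    ext a b
    simp [hσ]
  · rw [pluckerSeq_eq_zero fun h => hinj fun a b hab => Fin.ext (h hab)]
    simp only [Function.Injective, not_forall] at hinj
    obtain ⟨a, b, hab, hne⟩ := hinj
    exact (Matrix.det_zero_of_row_eq hne (by ext c; simp [hab])).symm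

/-- Multiplication by `t`, in terms of sequences. -/
def shiftT (K : Type*) [Field K] (n : ℕ) : (ℤ → K) →ₗ[K] (ℤ → K) :=
  LinearMap.funLeft K K fun i => i - n

theorem shiftT_apply (n : ℕ) (a : ℤ → K) (i : ℤ) : shiftT K n a i = a (i - n) := rfl

theorem shiftT_pow_apply (n k : ℕ) (a : ℤ → K) (i : ℤ) :
    (shiftT K n ^ k) a i = a (i - k * n) := by
  induction k generalizing i with
  | zero => simp
  | succ k ih =>
    rw [pow_succ', Module.End.mul_apply, shiftT_apply, ih]
    congr 1
    push_cast
    ring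

theorem Corresponds.shiftT {n : ℕ} {a : ℤ → K} {x : Fin n → K⸨X⸩} (h : Corresponds a x) :
    Corresponds (shiftT K n a) ((PowerSeries.X : K⟦X⟧) • x) := by
  intro c i
  have h1 : ((PowerSeries.X : K⟦X⟧) • x) i = HahnSeries.single (1 : ℤ) (1 : K) * x i := by
    rw [Pi.smul_apply, Algebra.smul_def, LaurentSeries.coe_algebraMap, HahnSeries.ofPowerSeries_X]
  have h2 := HahnSeries.coeff_single_mul_add (r := (1 : K)) (x := x i) (a := c - 1) (b := (1 : ℤ))
  rw [sub_add_cancel, one_mul, ← h1] at h2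
  rw [h2, ← h, shiftT_apply]
  congr 1
  ring

theorem shiftT_mem {n : ℕ} {V : Submodule K (ℤ → K)} (hV : V ∈ affGr₀ K n) {a : ℤ → K}
    (ha : a ∈ V) : shiftT K n a ∈ V := by
  obtain ⟨-, L, -, hL⟩ := hV
  obtain ⟨x, hx, hax⟩ := (hL a).1 ha
  exact (hL _).2 ⟨_, L.smul_mem _ hx, hax.shiftT⟩

theorem shiftT_mem_E {n : ℕ} {k : ℤ} {a : ℤ → K} (ha : a ∈ E K k) : shiftT K n a ∈ E K k :=
  fun j hj => ha (j - n) (by omega)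

/-- `det (1 - X U)` is a unit of `K[X]`, hence constant, and it equals `1` at `X = 0`. -/
theorem charpolyRev_eq_one {m : ℕ} {U : Matrix (Fin m) (Fin m) K} (hU : IsNilpotent U) :
    U.charpolyRev = 1 := by
  have h := Matrix.isUnit_charpolyRev_of_isNilpotent hU
  obtain ⟨c, -, hc⟩ := Polynomial.isUnit_iff.1 h
  have h0 := Matrix.eval_charpolyRev (M := U)
  rw [← hc, Polynomial.eval_C] at h0
  rw [← hc, h0, Polynomial.C_1]

/-- The sum is the coefficient of `X^ℓ` in `det (A + X A U)`, expanded multilinearly in the rows. As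
`U` is nilpotent, this polynomial is the constant `det A`. -/
theorem sum_det_piecewise_eq_zero {m : ℕ} (A : Matrix (Fin m) (Fin m) K)
    {U : Matrix (Fin m) (Fin m) K} (hU : IsNilpotent U) {ℓ : ℕ} (hℓ : 1 ≤ ℓ) :
    ∑ s ∈ powersetCard ℓ (univ : Finset (Fin m)),
      (Matrix.of (s.piecewise (fun i => (A * U) i) (fun i => A i))).det = 0 := by
  classical
  open Polynomial in
  have h1 : (A.map C + (X : K[X]) • (A * U).map C).det = C A.det := by
    have : A.map C + (X : K[X]) • (A * U).map C =
        A.map C * (1 - (X : K[X]) • (-U).map C) := by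
      rw [Matrix.map_mul, Matrix.mul_sub, Matrix.mul_one, Matrix.mul_smul, Matrix.map_neg]
      · rw [Matrix.mul_neg, smul_neg, sub_neg_eq_add]
      · simp
    rw [this, Matrix.det_mul, ← Matrix.charpolyRev, charpolyRev_eq_one hU.neg, mul_one,
      ← RingHom.mapMatrix_apply, ← RingHom.map_det]
  open Polynomial in
  have h2 : (A.map C + (X : K[X]) • (A * U).map C).det =
      ∑ s : Finset (Fin m), (X : K[X]) ^ s.card *
        C (Matrix.of (s.piecewise (fun i => (A * U) i) (fun i => A i))).det := by
    have := (Matrix.detRowAlternating (n := Fin m) (R := K[X])).toMultilinearMap.map_add_univ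
      ((X : K[X]) • (A * U).map C) (A.map C)
    rw [add_comm (A.map C)]
    refine this.trans (sum_congr rfl fun s _ => ?_)
    rw [RingHom.map_det]
    have h3 := (Matrix.detRowAlternating (n := Fin m) (R := K[X])).toMultilinearMap.map_piecewise_smul
      (fun _ => (X : K[X])) (s.piecewise ((A * U).map C) (A.map C)) s
    rw [prod_const, smul_eq_mul] at h3
    have e1 : s.piecewise ((X : K[X]) • (A * U).map C) (A.map C) =
        s.piecewise (fun i => (X : K[X]) • s.piecewise ((A * U).map C) (A.map C) i)
          (s.piecewise ((A * U).map C) (A.map C)) := by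
      funext i
      by_cases hi : i ∈ s
      · simp only [Finset.piecewise, if_pos hi]
        rfl
      · simp only [Finset.piecewise, if_neg hi]
    have e2 : (C : K →+* K[X]).mapMatrix
        (Matrix.of (s.piecewise (fun i => (A * U) i) (fun i => A i))) =
        s.piecewise ((A * U).map C) (A.map C) := by
      funext i
      by_cases hi : i ∈ s
      · funext j
        simp only [RingHom.mapMatrix_apply, Matrix.map_apply, Matrix.of_apply, Finset.piecewise,
          if_pos hi]
      · funext j
        simp only [RingHom.mapMatrix_apply, Matrix.map_apply, Matrix.of_apply, Finset.piecewise,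
          if_neg hi]
    rw [e1, e2]
    exact h3
  have h3 := congrArg (fun p => Polynomial.coeff p ℓ) (h1.symm.trans h2)
  simp only [Polynomial.coeff_C, Polynomial.finsetSum_coeff, Polynomial.coeff_X_pow_mul',
    if_neg (show ℓ ≠ 0 by omega)] at h3
  rw [h3, ← sum_filter_add_sum_filter_not univ (fun s : Finset (Fin m) => s.card = ℓ)]
  rw [sum_eq_zero (s := univ.filter fun s : Finset (Fin m) => ¬ s.card = ℓ), add_zero]
  · refine sum_congr (by ext; simp) fun s hs => ?_
    have hs' : s.card = ℓ := by simpa using hs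
    simp [hs']
  · intro s hs
    have : s.card ≠ ℓ := by simpa using hs
    split_ifs
    · omega
    · rfl
    · rfl

theorem exists_nilpotent_matrix {n : ℕ} (hn : 1 ≤ n) {V : Submodule K (ℤ → K)} (hV : V ∈ affGr₀ K n)
    {M : ℕ} {v : Fin M → ℤ → K} (hv : IsFrame V M v) :
    ∃ U : Matrix (Fin M) (Fin M) K, IsNilpotent U ∧
      ∀ b, shiftT K n (v b) - ∑ c, U c b • v c ∈ E K (M + 1) := by
  have h1 : ∀ b, ∃ u : Fin M → K, shiftT K n (v b) - ∑ c, u c • v c ∈ E K (M + 1) := by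
    intro b
    have hb : v b ∈ V := hv.1 ▸ Submodule.mem_sup_left (Submodule.subset_span ⟨b, rfl⟩)
    have := shiftT_mem hV hb
    rw [hv.1] at this
    obtain ⟨y, hy, z, hz, hyz⟩ := Submodule.mem_sup.1 this
    obtain ⟨u, rfl⟩ := (Submodule.mem_span_range_iff_exists_fun K).1 hy
    exact ⟨u, by rwa [← hyz, add_sub_cancel_left]⟩
  choose u hu using h1
  let U : Matrix (Fin M) (Fin M) K := Matrix.of fun c b => u b c
  refine ⟨U, ?_, hu⟩
  have hpow : ∀ (k : ℕ) (b), (shiftT K n ^ k) (v b) - ∑ c, (U ^ k) c b • v c ∈ E K (M + 1) := by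
    intro k
    induction k with
    | zero => simp [Matrix.one_apply]
    | succ k ih =>
      intro b
      have e1 := shiftT_mem_E (n := n) (ih b)
      rw [map_sub, map_sum] at e1
      have e2 : ∑ c, (U ^ k) c b • (shiftT K n (v c) - ∑ d, U d c • v d) ∈ E K (M + 1) :=
        Submodule.sum_mem _ fun c _ => Submodule.smul_mem _ _ (hu c)
      have e3 := Submodule.add_mem _ e1 e2
      convert e3 using 1
      rw [pow_succ' (shiftT K n), Module.End.mul_apply]
      simp only [smul_sub, sum_sub_distrib, map_smul, smul_sum, smul_smul]
      rw [sub_add_sub_cancel]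
      congr 1
      rw [sum_comm]
      refine sum_congr rfl fun d _ => ?_
      rw [← sum_smul, pow_succ' U, Matrix.mul_apply]
      congr 1
      exact sum_congr rfl fun c _ => mul_comm _ _
  obtain ⟨⟨⟨B, -, hB⟩, -⟩, -⟩ := hV
  -- Since `V ⊆ E_{-B}` and `t` raises indices by `n ≥ 1`, this power of `t` maps `V` into
  -- `E_{M+1}`.
  refine ⟨B + M + 1, ?_⟩
  ext c b
  have hb : v b ∈ V := hv.1 ▸ Submodule.mem_sup_left (Submodule.subset_span ⟨b, rfl⟩)
  have h2 : (shiftT K n ^ (B + M + 1)) (v b) ∈ E K (M + 1) := by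
    intro j hj
    rw [shiftT_pow_apply]
    refine hB hb _ ?_
    push_cast
    nlinarith
  have h3 := Submodule.sub_mem _ h2 (hpow (B + M + 1) b)
  rw [sub_sub_cancel] at h3
  exact congrFun (linearIndependent_mkQ_iff.1 hv.2 _ h3) c

theorem shuffle_mem_linearIdeal {n : ℕ} (hn : 1 ≤ n) (I : Idx) (ℓ : ℕ+) :
    shuffle K n I ℓ ∈ linearIdeal (affGr₀ K n) := by
  intro V hV ω ⟨m, v₀, hv₀, hω₀⟩
  obtain ⟨M, hmM, hMd⟩ : ∃ M, m ≤ M ∧ I.deg + n * ℓ ≤ M :=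
    ⟨_, le_max_left _ _, le_max_right _ _⟩
  obtain ⟨v, hv, hmin⟩ := hv₀.exists_of_le hmM
  have hω : ∀ L, ω L = minor M v L := fun L => by rw [hω₀, hmin]
  have hI : I.Natural M := I.natural_deg.mono (by omega)
  obtain ⟨U, hU, hUv⟩ := exists_nilpotent_matrix hn hV hv
  have hIM : ∀ a : Fin M, I.1 a ≤ M := fun a => (I.apply_le a).trans (by have := a.2; omega)
  -- The right-hand zero becomes the sum of mixed determinants, compared termwise. Row `i_a - n` of
  -- the frame is row `a` of `A U`, because `t v_b` agrees with `∑ U_{cb} v_c` in all indices `≤ M`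
  -- and `i_a ≤ M`.
  rw [shuffle_eq_sum hn I ℓ hMd, LinearMap.sum_apply, sum_powersetCard_range,
    ← sum_det_piecewise_eq_zero (Matrix.of fun a b : Fin M => v b (I.1 a)) hU ℓ.2]
  refine sum_congr rfl fun s _ => ?_
  rw [pluckerSeq_apply_eq_det (lower_natural hI fun x hx => ?_) ?_ hω]
  · congr 1
    ext a b
    have hmem : (a : ℕ) ∈ s.map Fin.valEmbedding ↔ a ∈ s :=
      Finset.mem_map' Fin.valEmbedding
    by_cases ha : a ∈ s
    · have := hUv b (I.1 a) (by have := hIM a; omega)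
      rw [Pi.sub_apply, shiftT_apply, sub_eq_zero] at this
      simp [lower, hmem, ha, this, Matrix.mul_apply, mul_comm, -mem_map]
    · simp [lower, hmem, ha, -mem_map]
  · intro a
    have := hIM a
    rw [lower]
    split_ifs <;> omega
  · simp only [mem_map, Fin.valEmbedding_apply] at hx
    obtain ⟨a, -, rfl⟩ := hx
    simp

end AffGr

end

noncomputable section

namespace AffGr

open Finset Polynomial

/-! ### Matrices over `R[t⁻¹]` acting on sequences -/

section Action

variable (n : ℕ) [NeZero n] (R : Type*) [CommRing R]

/-- The identification `c n + (i + 1) ↔ (c, i)` of the indices. -/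
def idxEquiv : ℤ ≃ ℤ × Fin n := (Equiv.subRight 1).trans (Int.divModEquiv n)

theorem idxEquiv_symm_apply (c : ℤ) (p : Fin n) :
    (idxEquiv n).symm (c, p) = c * n + ((p : ℕ) + 1 : ℕ) := by
  simp [idxEquiv, Int.divModEquiv, add_assoc]

/-- A sequence, split into its residue classes modulo `n`. -/
def toBlocks : (ℤ → R) ≃ₗ[R] (Fin n → ℤ → R) where
  toFun a p c := a (c * n + ((p : ℕ) + 1 : ℕ))
  map_add' _ _ := rfl
  map_smul' _ _ := rfl
  invFun b i := b (idxEquiv n i).2 (idxEquiv n i).1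
  left_inv a := by
    funext i
    change a ((idxEquiv n i).1 * n + (((idxEquiv n i).2 : ℕ) + 1 : ℕ)) = a i
    rw [← idxEquiv_symm_apply, Prod.mk.eta, Equiv.symm_apply_apply]
  right_inv b := by
    funext p c
    simp only [← idxEquiv_symm_apply, Equiv.apply_symm_apply]

theorem toBlocks_apply (a : ℤ → R) (p : Fin n) (c : ℤ) :
    toBlocks n R a p c = a (c * n + ((p : ℕ) + 1 : ℕ)) := rfl

/-- The shift `b ↦ (c ↦ b (c + 1))`. -/
def shiftOne : Module.End R (ℤ → R) := LinearMap.funLeft R R fun c => c + 1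

variable {R}

theorem shiftOne_apply (b : ℤ → R) (c : ℤ) : shiftOne R b c = b (c + 1) := rfl

theorem shiftOne_pow_apply (k : ℕ) (b : ℤ → R) (c : ℤ) : (shiftOne R ^ k) b c = b (c + k) := by
  induction k generalizing c with
  | zero => simp
  | succ k ih =>
    rw [pow_succ', Module.End.mul_apply, shiftOne_apply, ih]
    congr 1
    push_cast
    ring

theorem aeval_shiftOne_apply (g : R[X]) {D : ℕ} (hD : g.natDegree ≤ D) (b : ℤ → R) (c : ℤ) :
    aeval (shiftOne R) g b c = ∑ k ∈ range (D + 1), g.coeff k * b (c + k) := by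
  rw [aeval_eq_sum_range' (Nat.lt_succ_of_le hD), LinearMap.sum_apply, Finset.sum_apply]
  simp [shiftOne_pow_apply]

variable {n}

/-- The action of matrices over `R[t⁻¹]` on sequences: `t⁻¹` shifts by `n`. -/
def act : Matrix (Fin n) (Fin n) R[X] →+* Module.End R (ℤ → R) :=
  ((toBlocks n R).symm.conjRingEquiv.toRingHom.comp
    (endVecRingEquivMatrixEnd (Fin n) R (ℤ → R)).symm.toRingHom).comp
    (RingHom.mapMatrix (aeval (shiftOne R) : R[X] →ₐ[R] Module.End R (ℤ → R)).toRingHom)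

theorem toBlocks_act (G : Matrix (Fin n) (Fin n) R[X]) (a : ℤ → R) (p : Fin n) :
    toBlocks n R (act G a) p = ∑ q, aeval (shiftOne R) (G p q) (toBlocks n R a q) := by
  have : act G a = (toBlocks n R).symm
      (fun p => ∑ q, aeval (shiftOne R) (G p q) (toBlocks n R a q)) := rfl
  rw [this, LinearEquiv.apply_symm_apply]

theorem act_apply (G : Matrix (Fin n) (Fin n) R[X]) {D : ℕ} (hD : ∀ p q, (G p q).natDegree ≤ D)
    (a : ℤ → R) (p : Fin n) (c : ℤ) :
    act G a (c * n + ((p : ℕ) + 1 : ℕ)) = ∑ q : Fin n, ∑ k ∈ range (D + 1),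
      (G p q).coeff k * a ((c + k) * n + ((q : ℕ) + 1 : ℕ)) := by
  rw [← toBlocks_apply n R (act G a), toBlocks_act, Finset.sum_apply]
  refine sum_congr rfl fun q _ => ?_
  rw [aeval_shiftOne_apply _ (hD p q)]
  rfl

theorem exists_block (n : ℕ) [NeZero n] (i : ℤ) :
    ∃ (c : ℤ) (p : Fin n), i = c * n + ((p : ℕ) + 1 : ℕ) :=
  ⟨(idxEquiv n i).1, (idxEquiv n i).2, by
    rw [← idxEquiv_symm_apply, Prod.mk.eta, Equiv.symm_apply_apply]⟩

theorem exists_natDegree_le {m : ℕ} (G : Matrix (Fin m) (Fin m) R[X]) :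
    ∃ D : ℕ, ∀ p q, (G p q).natDegree ≤ D :=
  ⟨univ.sup fun p => univ.sup fun q => (G p q).natDegree, fun p q =>
    (le_sup (f := fun q => (G p q).natDegree) (mem_univ q)).trans
      (le_sup (f := fun p => univ.sup fun q => (G p q).natDegree) (mem_univ p))⟩

/-- Change of coefficients: it links a generic matrix to its specialisations at `K`-points and to
its image over a quotient ring. -/
theorem act_map {R' : Type*} [CommRing R'] (φ : R →+* R') (G : Matrix (Fin n) (Fin n) R[X])
    (a : ℤ → R) (i : ℤ) :
    act ((mapRingHom φ).mapMatrix G) (fun j => φ (a j)) i = φ (act G a i) := by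
  obtain ⟨D, hD⟩ := exists_natDegree_le G
  obtain ⟨c, p, rfl⟩ := exists_block n i
  rw [act_apply _ (D := D), act_apply _ hD, map_sum]
  · refine sum_congr rfl fun q _ => ?_
    rw [map_sum]
    refine sum_congr rfl fun k _ => ?_
    simp
  · intro p q
    exact natDegree_map_le.trans (hD p q)

/-- Matrices over `R[t⁻¹]` of degree at most `D` lower the indices by at most `n D`. -/
theorem act_eq_zero_of_lt (G : Matrix (Fin n) (Fin n) R[X]) {D : ℕ}
    (hD : ∀ p q, (G p q).natDegree ≤ D) {a : ℤ → R} {k : ℤ}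
    (ha : ∀ j, j < k * n + 1 → a j = 0) {j : ℤ} (hj : j < (k - D) * n + 1) : act G a j = 0 := by
  obtain ⟨c, p, rfl⟩ := exists_block n j
  rw [act_apply G hD]
  have hn : (0 : ℤ) < n := by exact_mod_cast Nat.pos_of_neZero n
  have hc : c < k - D := by
    by_contra hc
    push_cast at hj
    nlinarith
  refine sum_eq_zero fun q _ => sum_eq_zero fun r hr => ?_
  rw [ha, mul_zero]
  have h1 : (r : ℤ) ≤ D := by have := mem_range.1 hr; omega
  have h2 : (q : ℤ) + 1 ≤ n := by have := q.2; omega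
  have h3 : c + r + 1 ≤ k := by omega
  push_cast
  nlinarith

/-- Matrices over `R[t⁻¹]` preserve the sequences bounded above by a multiple of `n`. -/
theorem act_eq_zero_of_gt (G : Matrix (Fin n) (Fin n) R[X]) {a : ℤ → R} {k : ℤ}
    (ha : ∀ j, k * n < j → a j = 0) {j : ℤ} (hj : k * n < j) : act G a j = 0 := by
  obtain ⟨D, hD⟩ := exists_natDegree_le G
  obtain ⟨c, p, rfl⟩ := exists_block n j
  rw [act_apply G hD]
  have hn : (0 : ℤ) < n := by exact_mod_cast Nat.pos_of_neZero n
  have hc : k ≤ c := by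
    by_contra hc
    have h2 : (p : ℤ) + 1 ≤ n := by have := p.2; omega
    push_cast at hj
    nlinarith
  refine sum_eq_zero fun q _ => sum_eq_zero fun r hr => ?_
  rw [ha, mul_zero]
  push_cast
  nlinarith

end Action

/-! ### The lattices in the opposite big cell -/

variable {K : Type*} [Field K] {n : ℕ} [NeZero n]

theorem aeval_apply_of_intertwine {R X Y : Type*} [CommRing R] [AddCommGroup X] [Module R X]
    [AddCommGroup Y] [Module R Y] {f : X →ₗ[R] Y} {A : Module.End R X} {B : Module.End R Y}
    (h : ∀ x, f (A x) = B (f x)) (p : R[X]) (x : X) : f (aeval A p x) = aeval B p (f x) := by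
  induction p using Polynomial.induction_on' with
  | add p q hp hq => simp [hp, hq]
  | monomial k r =>
    have : ∀ k : ℕ, f ((A ^ k) x) = (B ^ k) (f x) := by
      intro k
      induction k with
      | zero => rfl
      | succ k ih => rw [pow_succ', pow_succ', Module.End.mul_apply, h, ih, Module.End.mul_apply]
    simp [aeval_monomial, this, Algebra.algebraMap_eq_smul_one]

/-- The coefficients of a Laurent series. -/
def coeffMap (K : Type*) [Field K] : K⸨X⸩ →ₗ[K] (ℤ → K) where
  toFun x := x.coeff
  map_add' _ _ := rfl
  map_smul' _ _ := rfl

/-- The embedding `K[t⁻¹] → K((t))`. -/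
def polyInv (K : Type*) [Field K] : K[X] →+* K⸨X⸩ :=
  eval₂RingHom HahnSeries.C (HahnSeries.single (-1 : ℤ) (1 : K))

theorem coeffMap_polyInv_mul (g : K[X]) (x : K⸨X⸩) :
    coeffMap K (polyInv K g * x) = aeval (shiftOne K) g (coeffMap K x) := by
  induction g using Polynomial.induction_on' with
  | add p q hp hq => rw [map_add, add_mul, map_add, hp, hq, map_add, LinearMap.add_apply]
  | monomial k r =>
    have h1 : polyInv K (monomial k r) = HahnSeries.single (-(k : ℤ)) r := by
      rw [polyInv, coe_eval₂RingHom, eval₂_monomial, HahnSeries.single_pow]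
      simp [HahnSeries.C_apply]
    funext c
    have h2 := HahnSeries.coeff_single_mul_add (r := r) (x := x) (a := c + k) (b := (-k : ℤ))
    rw [add_neg_cancel_right, ← h1] at h2
    rw [aeval_monomial, Module.End.mul_apply, Module.algebraMap_end_apply, Pi.smul_apply,
      shiftOne_pow_apply]
    exact h2

theorem corresponds_iff {a : ℤ → K} {x : Fin n → K⸨X⸩} :
    Corresponds a x ↔ ∀ p, toBlocks n K a p = coeffMap K (x p) :=
  ⟨fun h p => funext fun c => h c p, fun h c p => congrFun (h p) c⟩

theorem toBlocks_act_of_eq {G : Matrix (Fin n) (Fin n) K[X]} {a : ℤ → K} {y : Fin n → K⸨X⸩}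
    (h : Corresponds a y) (p : Fin n) :
    toBlocks n K (act G a) p = coeffMap K (∑ q, polyInv K (G p q) * y q) := by
  rw [toBlocks_act, map_sum]
  refine sum_congr rfl fun q _ => ?_
  rw [coeffMap_polyInv_mul, ← corresponds_iff.1 h]

theorem exists_mem_E_one_corresponds (y : Fin n → K⟦X⟧) :
    ∃ a ∈ E K 1, Corresponds a fun q => (y q : K⸨X⸩) := by
  have hc : Corresponds ((toBlocks n K).symm fun q => coeffMap K (y q : K⸨X⸩))
      fun q => (y q : K⸨X⸩) := by
    rw [corresponds_iff]
    intro p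
    rw [LinearEquiv.apply_symm_apply]
  refine ⟨_, fun j hj => ?_, hc⟩
  obtain ⟨c, p, rfl⟩ := exists_block n j
  rw [hc, PowerSeries.coeff_coe, if_pos]
  by_contra h
  push_cast at hj
  nlinarith

theorem exists_corresponds_of_mem_E_one {n : ℕ} {a : ℤ → K} (ha : a ∈ E K 1) :
    ∃ y : Fin n → K⟦X⟧, Corresponds a fun q => (y q : K⸨X⸩) := by
  refine ⟨fun q => PowerSeries.mk fun k => a (k * n + ((q : ℕ) + 1 : ℕ)), fun c p => ?_⟩
  rw [PowerSeries.coeff_coe]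
  split_ifs with h
  · refine ha _ ?_
    have h2 : (p : ℤ) + 1 ≤ n := by have := p.2; omega
    push_cast
    nlinarith
  · rw [PowerSeries.coeff_mk]
    congr 3
    omega

/-- The subspace `G A^n` of `F^n`, for a matrix `G` over `K[t⁻¹]`. -/
def latticeOf (G : Matrix (Fin n) (Fin n) K[X]) : Submodule K (ℤ → K) := (E K 1).map (act G)

/-- The columns of `G` are independent over `K((t))`, hence over `K[[t]]`, so they form a basis of
the lattice `G A^n`. -/
theorem exists_lattice {G H : Matrix (Fin n) (Fin n) K[X]} (hGH : G * H = 1) :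
    ∃ L : Submodule K⟦X⟧ (Fin n → K⸨X⸩), IsLattice L ∧
      ∀ a : ℤ → K, a ∈ latticeOf G ↔ ∃ x ∈ L, Corresponds a x := by
  let G' : Matrix (Fin n) (Fin n) K⸨X⸩ := (polyInv K).mapMatrix G
  have hunit : IsUnit G' := by
    refine IsUnit.of_mul_eq_one ((polyInv K).mapMatrix H) ?_
    rw [← map_mul, hGH, map_one]
  have hli : LinearIndependent K⟦X⟧ G'.col :=
    (Matrix.linearIndependent_cols_of_isUnit hunit).restrict_scalars fun x y hxy => by
      exact HahnSeries.ofPowerSeries_injective (by simpa [Algebra.smul_def] using hxy)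
  refine ⟨Submodule.span K⟦X⟧ (Set.range G'.col), ⟨Module.Basis.span hli⟩, fun a => ?_⟩
  have hcol : ∀ (y : Fin n → K⟦X⟧) (p : Fin n),
      (∑ q, y q • G'.col q) p = ∑ q, polyInv K (G p q) * (y q : K⸨X⸩) := by
    intro y p
    rw [Finset.sum_apply]
    refine sum_congr rfl fun q _ => ?_
    rw [Pi.smul_apply, Algebra.smul_def, mul_comm]
    rfl
  constructor
  · rintro ⟨b, hb, rfl⟩
    obtain ⟨y, hy⟩ := exists_corresponds_of_mem_E_one (n := n) hb
    refine ⟨_, (Submodule.mem_span_range_iff_exists_fun _).2 ⟨y, rfl⟩, corresponds_iff.2 fun p => ?_⟩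
    rw [toBlocks_act_of_eq hy, hcol]
  · rintro ⟨x, hx, hax⟩
    obtain ⟨y, rfl⟩ := (Submodule.mem_span_range_iff_exists_fun _).1 hx
    obtain ⟨b, hb, hby⟩ := exists_mem_E_one_corresponds y
    refine ⟨b, hb, (toBlocks n K).injective (funext fun p => ?_)⟩
    rw [toBlocks_act_of_eq hby, corresponds_iff.1 hax, hcol]

theorem mem_span_single_of_bounded {M : ℕ} {a : ℤ → K} (h1 : a ∈ E K 1)
    (h2 : ∀ j, (M : ℤ) < j → a j = 0) :
    a ∈ Submodule.span K (Set.range fun b : Fin M => (Pi.single ((b : ℤ) + 1) 1 : ℤ → K)) := by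
  rw [Submodule.mem_span_range_iff_exists_fun]
  refine ⟨fun b => a ((b : ℤ) + 1), funext fun j => ?_⟩
  rw [Finset.sum_apply]
  simp only [Pi.smul_apply, Pi.single_apply, smul_eq_mul, mul_ite, mul_one, mul_zero]
  by_cases hj : 1 ≤ j ∧ j ≤ M
  · rw [Finset.sum_eq_single ⟨(j - 1).toNat, by omega⟩]
    · rw [if_pos (by simp; omega)]
      congr 1
      simp
      omega
    · intro b _ hb
      rw [if_neg]
      rintro rfl
      exact hb (Fin.ext (by simp))
    · simp
  · rw [sum_eq_zero]
    · by_cases h : j < 1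
      · rw [h1 j h]
      · rw [h2 j (by omega)]
    · intro b _
      rw [if_neg]
      have := b.2
      omega

/-- As `H = G⁻¹` lowers indices by at most `M' n`, it maps `E_{M'n+1}` into `E_1`, so `E_{M'n+1} ⊆ G
E_1`. Both `G` and `H` preserve the sequences supported in indices `≤ M' n`, which meet `E_{M'n+1}`
trivially. -/
theorem latticeOf_isFrame {G H : Matrix (Fin n) (Fin n) K[X]} (hGH : G * H = 1) {M' : ℕ}
    (hH : ∀ p q, (H p q).natDegree ≤ M') :
    IsFrame (latticeOf G) (M' * n)
      (fun b => act G (Pi.single ((b : ℤ) + 1) 1 : ℤ → K)) := by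
  have hHG : H * G = 1 := mul_eq_one_comm.1 hGH
  have hact : ∀ a : ℤ → K, act G (act H a) = a := fun a => by
    rw [← Module.End.mul_apply, ← map_mul, hGH, map_one]
    rfl
  have hact' : ∀ a : ℤ → K, act H (act G a) = a := fun a => by
    rw [← Module.End.mul_apply, ← map_mul, hHG, map_one]
    rfl
  have hlow : ∀ a ∈ E K ((M' * n : ℕ) + 1), act H a ∈ E K 1 := by
    intro a ha j hj
    refine act_eq_zero_of_lt H hH (k := M') (fun i hi => ha i (by push_cast; exact hi)) ?_
    simpa using hj
  have hup : ∀ (N : Matrix (Fin n) (Fin n) K[X]) (a : ℤ → K),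
      (∀ j, ((M' * n : ℕ) : ℤ) < j → a j = 0) → ∀ j, ((M' * n : ℕ) : ℤ) < j → act N a j = 0 := by
    intro N a ha j hj
    refine act_eq_zero_of_gt N (k := M') (fun i hi => ha i (by push_cast; exact hi)) ?_
    push_cast at hj
    exact hj
  have hspan : Submodule.span K (Set.range fun b : Fin (M' * n) =>
      act G (Pi.single ((b : ℤ) + 1) 1 : ℤ → K)) =
      (Submodule.span K (Set.range fun b : Fin (M' * n) =>
        (Pi.single ((b : ℤ) + 1) 1 : ℤ → K))).map (act G) := by
    rw [Submodule.map_span, ← Set.range_comp]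
    rfl
  refine ⟨le_antisymm ?_ (sup_le ?_ ?_), ?_⟩
  · rintro _ ⟨y, hy, rfl⟩
    set z := act G y
    -- Cutting at index `M' n` leaves `H z₀ = y - H z₁` in `E_1` and supported in indices `≤ M' n`,
    -- so it is a combination of `e_1, …, e_{M'n}`.
    let z₀ : ℤ → K := fun j => if j ≤ ((M' * n : ℕ) : ℤ) then z j else 0
    let z₁ : ℤ → K := fun j => if j ≤ ((M' * n : ℕ) : ℤ) then 0 else z j
    have hz : z = z₀ + z₁ := by
      funext j
      simp only [z₀, z₁, Pi.add_apply]
      split_ifs <;> simp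
    have hz₁ : z₁ ∈ E K ((M' * n : ℕ) + 1) := fun j hj => if_pos (by omega)
    have hz₀ : ∀ j, ((M' * n : ℕ) : ℤ) < j → z₀ j = 0 := fun j hj => if_neg (by omega)
    have hHz₀ : act H z₀ = y - act H z₁ := by
      rw [← hact' y, show act G y = z from rfl, hz, map_add, add_sub_cancel_right]
    rw [hz]
    refine Submodule.add_mem_sup ?_ hz₁
    rw [hspan]
    refine ⟨act H z₀, mem_span_single_of_bounded ?_ (hup H z₀ hz₀), hact z₀⟩
    rw [hHz₀]
    exact Submodule.sub_mem _ hy (hlow _ hz₁)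
  · rw [hspan]
    refine Submodule.map_mono ?_
    rw [E_one_isFrame (K := K) (M' * n) |>.1]
    exact le_sup_left
  · intro z hz
    exact ⟨act H z, hlow z hz, hact z⟩
  · rw [linearIndependent_mkQ_iff]
    intro c hc
    have h1 : ∑ b, c b • act G (Pi.single ((b : ℤ) + 1) 1 : ℤ → K) =
        act G (∑ b : Fin (M' * n), c b • (Pi.single ((b : ℤ) + 1) 1 : ℤ → K)) := by
      rw [map_sum]
      exact sum_congr rfl fun b _ => (map_smul _ _ _).symm
    rw [h1] at hc
    have h2 : ∀ j, ((M' * n : ℕ) : ℤ) < j →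
        (∑ b : Fin (M' * n), c b • (Pi.single ((b : ℤ) + 1) 1 : ℤ → K)) j = 0 := by
      intro j hj
      rw [Finset.sum_apply]
      refine sum_eq_zero fun b _ => ?_
      have : j ≠ (b : ℤ) + 1 := by have := b.2; omega
      simp [this]
    have h3 : act G (∑ b : Fin (M' * n), c b • (Pi.single ((b : ℤ) + 1) 1 : ℤ → K)) = 0 := by
      funext j
      by_cases hj : ((M' * n : ℕ) : ℤ) < j
      · exact hup G _ h2 j hj
      · exact hc j (by omega)
    have h4 : ∑ b : Fin (M' * n), c b • (Pi.single ((b : ℤ) + 1) 1 : ℤ → K) = 0 := by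
      rw [← hact' (∑ b : Fin (M' * n), c b • (Pi.single ((b : ℤ) + 1) 1 : ℤ → K)), h3, map_zero]
    funext b
    have := congrFun h4 ((b : ℤ) + 1)
    simpa [Finset.sum_apply, Pi.single_apply, Fin.val_inj] using this

theorem latticeOf_mem_affGr₀ {G H : Matrix (Fin n) (Fin n) K[X]} (hGH : G * H = 1) :
    latticeOf G ∈ affGr₀ K n := by
  obtain ⟨D, hD⟩ := exists_natDegree_le G
  obtain ⟨M', hM'⟩ := exists_natDegree_le H
  refine ⟨(latticeOf_isFrame hGH hM').mem_infGr₀ (B := D * n) ?_, exists_lattice hGH⟩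
  rintro _ ⟨y, hy, rfl⟩ j hj
  refine act_eq_zero_of_lt G hD (k := 0) (fun i hi => hy i (by simpa using hi)) ?_
  push_cast at hj
  linarith

end AffGr

end

noncomputable section

namespace AffGr

open Finset Polynomial

/-! ### Products of unitriangular matrices -/

section Unitriangular

variable {n : ℕ} {S : Type*} [CommRing S]

/-- Triangular (upper or lower) matrices with ones on the diagonal. -/
def IsUnitriangular (g : Matrix (Fin n) (Fin n) S) : Prop :=
  (∀ i, g i i = 1) ∧ ((∀ i j, j < i → g i j = 0) ∨ (∀ i j, i < j → g i j = 0))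

theorem IsUnitriangular.det {g : Matrix (Fin n) (Fin n) S} (hg : IsUnitriangular g) :
    g.det = 1 := by
  obtain ⟨h1, h | h⟩ := hg
  · rw [Matrix.det_of_isUpperTriangular fun i j hij => h i j hij]
    exact prod_eq_one fun i _ => h1 i
  · rw [Matrix.det_of_isLowerTriangular g fun i j hij => h i j (by simpa using hij)]
    exact prod_eq_one fun i _ => h1 i

variable (n S) in
/-- The monoid generated by the unitriangular matrices. -/
def unitriangular : Submonoid (Matrix (Fin n) (Fin n) S) := Submonoid.closure {g | IsUnitriangular g}

/-- An entrywise lift of an arbitrary matrix of determinant `1` need not keep the determinant; for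
unitriangular factors it does. -/
theorem exists_lift_of_mem_unitriangular {S' : Type*} [CommRing S'] {φ : S →+* S'}
    (hφ : Function.Surjective φ) {g : Matrix (Fin n) (Fin n) S'} (hg : g ∈ unitriangular n S') :
    ∃ G : Matrix (Fin n) (Fin n) S, G.det = 1 ∧ φ.mapMatrix G = g := by
  classical
  induction hg using Submonoid.closure_induction with
  | mem g hg =>
    -- Zero entries are lifted to zero so that the lift stays triangular on the same side.
    refine ⟨Matrix.of fun i j => if i = j then 1 else if g i j = 0 then 0 else
      Function.surjInv hφ (g i j), IsUnitriangular.det ⟨fun i => by simp, ?_⟩, ?_⟩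
    · refine hg.2.imp (fun h i j hij => ?_) (fun h i j hij => ?_)
      · simp [hij.ne', h i j hij]
      · simp [hij.ne, h i j hij]
    · ext i j
      by_cases hij : i = j
      · subst hij
        simp [hg.1]
      · by_cases h0 : g i j = 0
        · simp [hij, h0]
        · simp [hij, h0, Function.surjInv_eq]
  | one => exact ⟨1, Matrix.det_one, map_one _⟩
  | mul g g' _ _ h h' =>
    obtain ⟨G, hG, rfl⟩ := h
    obtain ⟨G', hG', rfl⟩ := h'
    exact ⟨G * G', by rw [Matrix.det_mul, hG, hG', one_mul], map_mul _ _ _⟩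

/-- Conjugation by an invertible diagonal matrix preserves unitriangularity, so diagonal factors can
be collected on the right. -/
theorem diagonal_mul_mem_unitriangular (d : Fin n → Sˣ) {g : Matrix (Fin n) (Fin n) S}
    (hg : g ∈ unitriangular n S) :
    ∃ g' ∈ unitriangular n S, Matrix.diagonal (fun i => (d i : S)) * g =
      g' * Matrix.diagonal (fun i => (d i : S)) := by
  induction hg using Submonoid.closure_induction with
  | mem g hg =>
    refine ⟨Matrix.of fun i j => (d i : S) * g i j * ((d j)⁻¹ : Sˣ), Submonoid.subset_closure
      ⟨fun i => by simp [hg.1], ?_⟩, ?_⟩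
    · refine hg.2.imp (fun h i j hij => ?_) (fun h i j hij => ?_) <;> simp [h i j hij]
    · ext i j
      simp [Matrix.diagonal_mul, Matrix.mul_diagonal]
  | one => exact ⟨1, Submonoid.one_mem _, by rw [mul_one, one_mul]⟩
  | mul g₁ g₂ _ _ h₁ h₂ =>
    obtain ⟨g₁', h₁, e₁⟩ := h₁
    obtain ⟨g₂', h₂, e₂⟩ := h₂
    exact ⟨_, Submonoid.mul_mem _ h₁ h₂, by rw [← mul_assoc, e₁, mul_assoc, e₂, mul_assoc]⟩

/-- The diagonal matrix with entries `1, …, 1, u`. -/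
def lastDiagonal (n : ℕ) (u : Sˣ) : Matrix (Fin n) (Fin n) S :=
  Matrix.diagonal fun i => (((if (i : ℕ) + 1 = n then u else 1 : Sˣ)) : S)

theorem lastDiagonal_mul (u v : Sˣ) :
    lastDiagonal n (u * v) = lastDiagonal n u * lastDiagonal n v := by
  rw [lastDiagonal, lastDiagonal, lastDiagonal, Matrix.diagonal_mul_diagonal]
  congr 1
  funext i
  split_ifs <;> simp

/-- The matrix of `u⁻¹`, for the `n`-th root `u` of `t`. -/
def rootMatrix (n : ℕ) (R : Type*) [CommRing R] : Matrix (Fin n) (Fin n) R[X] :=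
  Matrix.of fun p q => if (q : ℕ) = p + 1 then 1 else if (p : ℕ) + 1 = n ∧ (q : ℕ) = 0 then X else 0

variable {R : Type*} [CommRing R]

/-- The factorization `L D U` of `1 - x u⁻¹` has pivots `1, …, 1, 1 - x^n t⁻¹`; then `D` is moved
past `U`. -/
theorem one_sub_rootMatrix_eq (x : R) (u : R[X]ˣ) (hu : (u : R[X]) = 1 - C x ^ n * X) :
    ∃ e ∈ unitriangular n R[X], 1 - x • rootMatrix n R = e * lastDiagonal n u := by
  let L : Matrix (Fin n) (Fin n) R[X] := Matrix.of fun i j =>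
    if i = j then 1 else if (i : ℕ) + 1 = n then - (C x ^ ((j : ℕ) + 1) * X) else 0
  let U : Matrix (Fin n) (Fin n) R[X] := Matrix.of fun i j =>
    if i = j then 1 else if (j : ℕ) = i + 1 then - C x else 0
  have hL : L ∈ unitriangular n R[X] := by
    refine Submonoid.subset_closure ⟨fun i => by simp [L], Or.inr fun i j hij => ?_⟩
    have h1 : (i : ℕ) < j := hij
    have := j.2
    simp only [L, Matrix.of_apply]
    rw [if_neg hij.ne, if_neg (by omega)]
  have hU : U ∈ unitriangular n R[X] := by
    refine Submonoid.subset_closure ⟨fun i => by simp [U], Or.inl fun i j hij => ?_⟩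
    have h1 : (j : ℕ) < i := hij
    simp only [U, Matrix.of_apply]
    rw [if_neg hij.ne', if_neg (by omega)]
  obtain ⟨U', hU', e⟩ := diagonal_mul_mem_unitriangular
    (fun i : Fin n => if (i : ℕ) + 1 = n then u else 1) hU
  refine ⟨L * U', Submonoid.mul_mem _ hL hU', ?_⟩
  rw [mul_assoc, lastDiagonal, ← e]
  ext1 i j
  have hR : ∀ k, (Matrix.diagonal (fun i : Fin n => (((if (i : ℕ) + 1 = n then u else 1 :
      R[X]ˣ)) : R[X])) * U) k j = (if (k : ℕ) + 1 = n then 1 - C x ^ n * X else 1) *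
      (if k = j then 1 else if (j : ℕ) = k + 1 then - C x else 0) := by
    intro k
    rw [Matrix.diagonal_mul]
    simp only [U, Matrix.of_apply]
    congr 1
    split_ifs <;> simp [hu]
  have hB : (1 - x • rootMatrix n R) i j = (if i = j then 1 else 0) - C x *
      (if (j : ℕ) = i + 1 then 1 else if (i : ℕ) + 1 = n ∧ (j : ℕ) = 0 then X else 0) := by
    rw [Matrix.sub_apply, Matrix.one_apply, Matrix.smul_apply, smul_eq_C_mul]
    rfl
  rw [hB, Matrix.mul_apply]
  simp only [hR, L, Matrix.of_apply]
  have hi := i.2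
  have hj := j.2
  by_cases hin : (i : ℕ) + 1 = n
  · have h1 : ∀ k : Fin n, (if i = k then (1 : R[X]) else if (i : ℕ) + 1 = n then
          - (C x ^ ((k : ℕ) + 1) * X) else 0) * ((if (k : ℕ) + 1 = n then 1 - C x ^ n * X else 1) *
          (if k = j then 1 else if (j : ℕ) = k + 1 then - C x else 0)) =
        (if k = j then (if i = j then 1 - C x ^ n * X else - (C x ^ ((j : ℕ) + 1) * X)) else 0) +
        (if (j : ℕ) = k + 1 then C x ^ ((j : ℕ) + 1) * X else 0) := by
      intro k
      have hk := k.2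
      by_cases hkj : k = j
      · subst hkj
        by_cases hik : i = k
        · subst hik
          have : (i : ℕ) ≠ n := hi.ne
          simp [hin, this]
        · have : (k : ℕ) + 1 ≠ n := fun h => hik (Fin.ext (by omega))
          simp [hin, hik, this]
      · by_cases hjk : (j : ℕ) = k + 1
        · have h2 : (k : ℕ) + 1 ≠ n := by omega
          have h3 : i ≠ k := fun h => h2 (by rw [← h]; exact hin)
          simp [hkj, hjk, h2, h3, hin]
          ring
        · simp [hkj, hjk]
    rw [sum_congr rfl fun k _ => h1 k, sum_add_distrib, sum_ite_eq' univ j]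
    simp only [mem_univ, if_true]
    by_cases hj0 : (j : ℕ) = 0
    · rw [sum_eq_zero fun k _ => if_neg (by omega)]
      by_cases hij : i = j
      · have hn1 : n = 1 := by rw [← hin, hij, hj0]
        have : ¬ (j : ℕ) = j + 1 := by omega
        simp [hij, hj0, hn1]
      · have : ¬ (j : ℕ) = i + 1 := by omega
        have hn0 : 0 ≠ n := by omega
        simp [hij, hj0, hin, hn0]
    · rw [sum_eq_single ⟨(j : ℕ) - 1, by omega⟩]
      · have h2 : (j : ℕ) = j - 1 + 1 := by omega
        have h3 : ¬ (j : ℕ) = i + 1 := by omega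
        rw [if_neg h3, if_neg (show ¬((i : ℕ) + 1 = n ∧ (j : ℕ) = 0) from fun h => hj0 h.2), if_pos h2]
        by_cases hij : i = j
        · have : (j : ℕ) + 1 = n := by rw [← hij]; exact hin
          simp [hij, this]
        · simp [hij]
      · intro k _ hk
        refine if_neg fun h => hk (Fin.ext ?_)
        simp only
        omega
      · simp
  · rw [sum_eq_single i]
    · by_cases hij : i = j
      · subst hij
        simp [hin]
      · by_cases hji : (j : ℕ) = i + 1
        · simp [hin, hij, hji]
        · simp [hin, hij, hji]
    · intro k _ hk
      simp [hin, hk.symm]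
    · simp

/-- Nilpotence makes each last pivot `1 - x_i^n t⁻¹` a unit. The diagonal parts collect into the
product of these pivots, which is `1` by hypothesis. -/
theorem prod_one_sub_rootMatrix_mem {ι : Type*} [Fintype ι] (x : ι → R)
    (hx : ∀ i, IsNilpotent (x i)) (hn : n ≠ 0)
    (h : ∏ i, (1 - C (x i) ^ n * X : R[X]) = 1) :
    aeval (rootMatrix n R) (∏ i, (1 - C (x i) * X)) ∈ unitriangular n R[X] := by
  classical
  have hunit : ∀ i, ∃ u : R[X]ˣ, (u : R[X]) = 1 - C (x i) ^ n * X := fun i => by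
    have : IsNilpotent (C (x i) ^ n * X : R[X]) :=
      (Commute.all _ _).isNilpotent_mul_right (((hx i).map C).pow_of_pos hn)
    exact this.isUnit_one_sub
  choose u hu using hunit
  have key : ∀ s : Finset ι, ∃ e ∈ unitriangular n R[X],
      aeval (rootMatrix n R) (∏ i ∈ s, (1 - C (x i) * X)) = e * lastDiagonal n (∏ i ∈ s, u i) := by
    intro s
    induction s using Finset.induction_on with
    | empty =>
      refine ⟨1, Submonoid.one_mem _, ?_⟩
      rw [prod_empty, prod_empty, map_one, one_mul, lastDiagonal]
      simp
    | insert i s his ih =>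
      obtain ⟨e, he, e1⟩ := ih
      obtain ⟨e', he', e2⟩ := one_sub_rootMatrix_eq (n := n) (x i) (u i) (hu i)
      obtain ⟨e'', he'', e3⟩ := diagonal_mul_mem_unitriangular
        (fun j : Fin n => if (j : ℕ) + 1 = n then u i else 1) he
      refine ⟨e' * e'', Submonoid.mul_mem _ he' he'', ?_⟩
      have e4 : aeval (rootMatrix n R) (1 - C (x i) * X : R[X]) = 1 - x i • rootMatrix n R := by
        rw [map_sub, map_one, ← smul_eq_C_mul, map_smul, aeval_X]
      rw [prod_insert his, prod_insert his, map_mul, e4, e1, e2, lastDiagonal_mul, mul_assoc,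
        ← mul_assoc (lastDiagonal n (u i)), lastDiagonal, e3]
      simp only [mul_assoc]
  obtain ⟨e, he, e1⟩ := key univ
  have : ∏ i, u i = 1 := Units.ext (by rw [Units.coe_prod, Units.val_one, ← h]; simp [hu])
  rw [e1, this]
  convert he
  rw [lastDiagonal]
  simp

end Unitriangular

/-! ### Polynomials in `u⁻¹` -/

section Root

variable {n : ℕ} [NeZero n] {R : Type*} [CommRing R]

theorem act_rootMatrix : act (rootMatrix n R) = shiftOne R := by
  refine LinearMap.ext fun a => (toBlocks n R).injective (funext fun p => funext fun c => ?_)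
  rw [toBlocks_act, Finset.sum_apply, toBlocks_apply, shiftOne_apply]
  have hp := p.2
  by_cases hpn : (p : ℕ) + 1 = n
  · rw [sum_eq_single 0]
    · have h0 : ((0 : Fin n) : ℕ) = 0 := rfl
      simp only [rootMatrix, Matrix.of_apply, h0]
      rw [if_neg (by omega), if_pos ⟨hpn, trivial⟩, aeval_X, shiftOne_apply, toBlocks_apply, h0]
      congr 1
      have : ((n : ℕ) : ℤ) = p + 1 := by exact_mod_cast hpn.symm
      push_cast
      rw [this]
      ring
    · intro q _ hq
      have hq' := q.2
      have : (q : ℕ) ≠ 0 := fun h => hq (Fin.ext h)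
      simp only [rootMatrix, Matrix.of_apply]
      rw [if_neg (by omega), if_neg (fun h => this h.2)]
      simp
    · simp
  · rw [sum_eq_single ⟨p + 1, by omega⟩]
    · simp only [rootMatrix, Matrix.of_apply, if_true, map_one, Module.End.one_apply,
        toBlocks_apply]
      congr 1
      push_cast
      ring
    · intro q _ hq
      have : (q : ℕ) ≠ p + 1 := fun h => hq (Fin.ext h)
      simp only [rootMatrix, Matrix.of_apply]
      rw [if_neg this, if_neg (fun h => hpn h.1)]
      simp
    · simp

theorem act_aeval_rootMatrix (p : R[X]) :
    act (aeval (rootMatrix n R) p) = aeval (shiftOne R) p := by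
  have : act.comp (aeval (rootMatrix n R)).toRingHom =
      (aeval (shiftOne R) : R[X] →ₐ[R] Module.End R (ℤ → R)).toRingHom := by
    refine Polynomial.ringHom_ext (fun r => ?_) ?_
    · refine LinearMap.ext fun a => (toBlocks n R).injective (funext fun p => ?_)
      simp only [RingHom.comp_apply, AlgHom.toRingHom_eq_coe, RingHom.coe_coe, aeval_C]
      rw [toBlocks_act, sum_eq_single p]
      · simp [Matrix.algebraMap_matrix_apply, aeval_C]
      · intro q _ hq
        simp [Matrix.algebraMap_matrix_apply, hq.symm]
      · simp
    · simp only [RingHom.comp_apply, AlgHom.toRingHom_eq_coe, RingHom.coe_coe, aeval_X]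
      exact act_rootMatrix
  exact congrArg (fun φ : R[X] →+* Module.End R (ℤ → R) => φ p) this

theorem act_map_single {R' : Type*} [CommRing R'] (φ : R →+* R')
    (G : Matrix (Fin n) (Fin n) R[X]) (j i : ℤ) :
    act ((mapRingHom φ).mapMatrix G) (Pi.single j 1 : ℤ → R') i = φ (act G (Pi.single j 1) i) := by
  rw [← act_map]
  have : (Pi.single j 1 : ℤ → R') = fun k => φ ((Pi.single j 1 : ℤ → R) k) := by
    funext k
    simp only [Pi.single_apply]
    split_ifs <;> simp
  rw [this]

/-- The coefficients of a power series, indexed by integers. -/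
def coeffZ (H : R⟦X⟧) (k : ℤ) : R := if 0 ≤ k then PowerSeries.coeff k.toNat H else 0

/-- The sequence `i ↦ h_{j-i}` stands for `H(u⁻¹) e_j`, on which `p(u⁻¹)` acts by multiplying the
series. -/
theorem aeval_shiftOne_coeffZ (p : R[X]) (H : R⟦X⟧) (j : ℤ) :
    aeval (shiftOne R) p (fun i => coeffZ H (j - i)) = fun i => coeffZ ((p : R⟦X⟧) * H) (j - i) := by
  let f : R⟦X⟧ →ₗ[R] (ℤ → R) :=
    { toFun := fun H i => coeffZ H (j - i)
      map_add' := fun A B => by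
        funext i
        simp only [coeffZ, Pi.add_apply]
        split_ifs <;> simp
      map_smul' := fun r A => by
        funext i
        simp only [coeffZ, Pi.smul_apply]
        split_ifs <;> simp }
  have h := aeval_apply_of_intertwine (f := f) (A := LinearMap.mulLeft R (PowerSeries.X : R⟦X⟧))
    (B := shiftOne R) (fun x => ?_) p H
  · have h2 : aeval (LinearMap.mulLeft R (PowerSeries.X : R⟦X⟧)) p =
        LinearMap.mulLeft R (p : R⟦X⟧) := by
      rw [← Polynomial.eval₂_C_X_eq_coe]
      have h3 := aeval_algHom_apply (Algebra.lmul R R⟦X⟧) PowerSeries.X p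
      rw [aeval_def PowerSeries.X] at h3
      exact h3
    rw [h2] at h
    exact h.symm
  · funext i
    change coeffZ (PowerSeries.X * x) (j - i) = coeffZ x (j - (i + 1))
    simp only [coeffZ]
    rcases lt_trichotomy (j - i) 0 with h | h | h
    · rw [if_neg (by omega), if_neg (by omega)]
    · rw [if_pos (by omega), if_neg (by omega), h]
      simp
    · rw [if_pos (by omega), if_pos (by omega)]
      have : (j - i).toNat = (j - (i + 1)).toNat + 1 := by omega
      rw [this, PowerSeries.coeff_succ_X_mul]

theorem coeffZ_one (j : ℤ) : (fun i => coeffZ (1 : R⟦X⟧) (j - i)) = Pi.single j 1 := by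
  funext i
  rw [coeffZ, PowerSeries.coeff_one]
  by_cases h : i = j
  · simp [h]
  · rw [Pi.single_eq_of_ne h]
    split_ifs <;> first | rfl | omega

end Root

/-! ### Relations satisfied by linear forms vanishing on the affine Grassmannian -/

variable {K : Type*} [Field K] {n : ℕ} [NeZero n]

/-- The sequences which are natural beyond `M` and start at `-B` or later. -/
def boundedIdx (M B : ℕ) : Finset Idx :=
  (((Idx.finite_deg_le (M * (B + 1))).subset
    (fun _ h => Idx.deg_le_of_le h.1 h.2) :
      {I : Idx | I.Natural M ∧ -(B : ℤ) ≤ I.1 0}.Finite)).toFinset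

theorem mem_boundedIdx {M B : ℕ} {I : Idx} :
    I ∈ boundedIdx M B ↔ I.Natural M ∧ -(B : ℤ) ≤ I.1 0 := by
  simp [boundedIdx]

theorem sum_minor_eq_zero {f : LinForm K} (hf : f ∈ linearIdeal (affGr₀ K n))
    {G H : Matrix (Fin n) (Fin n) K[X]} (hGH : G * H = 1) {D M' B : ℕ}
    (hG : ∀ p q, (G p q).natDegree ≤ D) (hH : ∀ p q, (H p q).natDegree ≤ M') (hB : D * n ≤ B)
    (hM' : M' ≠ 0) :
    ∑ I ∈ boundedIdx (M' * n) B, f (Finsupp.single I 1) *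
      (Matrix.of fun a b : Fin (M' * n) =>
        act G (Pi.single ((b : ℤ) + 1) 1 : ℤ → K) (I.1 a)).det = 0 := by
  classical
  have hM0 : 0 < M' * n := Nat.mul_pos (Nat.pos_of_ne_zero hM') (Nat.pos_of_neZero n)
  set w : Fin (M' * n) → ℤ → K := fun b => act G (Pi.single ((b : ℤ) + 1) 1 : ℤ → K)
  let ω : Wedge K := Finsupp.onFinset (boundedIdx (M' * n) B) (minor (M' * n) w) (by
    intro I hI
    rw [minor] at hI
    by_cases h : ∀ j, M' * n ≤ j → I.1 j = j + 1
    · rw [if_pos h] at hI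
      refine mem_boundedIdx.2 ⟨h, ?_⟩
      -- `G` lowers indices by at most `D n ≤ B`, so a first row below `-B` is zero. Row `0` exists
      -- because `M' ≠ 0`.
      by_contra hlt
      refine hI (Matrix.det_eq_zero_of_row_eq_zero ⟨0, hM0⟩ fun b => ?_)
      refine act_eq_zero_of_lt G hG (k := 0) (fun j hj => ?_) ?_
      · exact Pi.single_eq_of_ne (by omega) _
      · have h1 : ((D * n : ℕ) : ℤ) ≤ B := by exact_mod_cast hB
        push_cast at h1
        simp only
        linarith
    · rw [if_neg h] at hI
      exact absurd rfl hI)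
  have h := hf _ (latticeOf_mem_affGr₀ hGH) ω ⟨_, w, latticeOf_isFrame hGH hH, fun I => rfl⟩
  rw [← ω.sum_single, Finsupp.onFinset_sum _ (fun I => Finsupp.single_zero I), map_sum] at h
  rw [← h]
  refine sum_congr rfl fun I hI => ?_
  have hnat : ∀ j, M' * n ≤ j → I.1 j = j + 1 := (mem_boundedIdx.1 hI).1
  have hsm : ∀ c : K, f (Finsupp.single I c) = f (Finsupp.single I 1) * c := fun c => by
    rw [mul_comm, ← smul_eq_mul, ← map_smul, Finsupp.smul_single, smul_eq_mul, mul_one]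
  rw [minor, if_pos hnat]
  exact (hsm _).symm

/-- If `x_1, …, x_m` are nilpotent elements of a `K`-algebra with `∏ (1 - x_i ^ n t⁻¹) = 1`, then
the coordinates of `∏ (1 - x_i u⁻¹)⁻¹`, with `u ^ n = t`, satisfy the linear relations of the affine
Grassmannian. -/
theorem sum_det_coeffZ_eq_zero [IsAlgClosed K] {f : LinForm K}
    (hf : f ∈ linearIdeal (affGr₀ K n)) {R : Type*} [CommRing R] [Algebra K R] {ι : Type*}
    [Fintype ι] (x : ι → R) (hx : ∀ i, IsNilpotent (x i))
    (h : ∏ i, (1 - C (x i) ^ n * X : R[X]) = 1) (H : R⟦X⟧)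
    (hH : ((∏ i, (1 - C (x i) * X) : R[X]) : R⟦X⟧) * H = 1) (N : ℕ) :
    ∃ M B : ℕ, N ≤ M ∧ N ≤ B ∧ ∑ I ∈ boundedIdx M B, f (Finsupp.single I 1) •
      (Matrix.of fun a b : Fin M => coeffZ H ((b : ℤ) + 1 - I.1 a)).det = 0 := by
  -- One variable per element of `R`: in this polynomial ring, unlike in `R`, identities can be
  -- tested at `K`-points.
  let φ : MvPolynomial R K →ₐ[K] R := MvPolynomial.aeval id
  have hφ : Function.Surjective φ := fun r => ⟨MvPolynomial.X r, MvPolynomial.aeval_X _ _⟩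
  obtain ⟨Q, hdet, hQ⟩ := exists_lift_of_mem_unitriangular
    (φ := mapRingHom (φ : MvPolynomial R K →+* R)) (Polynomial.map_surjective _ hφ)
    (prod_one_sub_rootMatrix_mem x hx (NeZero.ne n) h)
  set G := Q.adjugate
  have hGQ : G * Q = 1 := by rw [Matrix.adjugate_mul, hdet, one_smul]
  obtain ⟨D, hD⟩ := exists_natDegree_le G
  obtain ⟨M₀, hM₀⟩ := exists_natDegree_le Q
  have hM'N : N ≤ (M₀ + N + 1) * n :=
    (by omega : N ≤ M₀ + N + 1).trans (Nat.le_mul_of_pos_right _ (Nat.pos_of_neZero n))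
  refine ⟨(M₀ + N + 1) * n, D * n + N, hM'N, by omega, ?_⟩
  set M' := M₀ + N + 1
  let W : Fin (M' * n) → ℤ → MvPolynomial R K := fun b => act G (Pi.single ((b : ℤ) + 1) 1)
  let q : MvPolynomial R K := ∑ I ∈ boundedIdx (M' * n) (D * n + N),
    f (Finsupp.single I 1) • (Matrix.of fun a b : Fin (M' * n) => W b (I.1 a)).det
  have hq : q = 0 := by
    -- At each `K`-point the specialisations of `G` and `Q` are inverse to each other and give a
    -- genuine lattice, with degree bounds independent of the point.
    refine MvPolynomial.funext fun y => ?_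
    rw [map_zero, map_sum]
    rw [← sum_minor_eq_zero hf (G := (mapRingHom (MvPolynomial.eval y)).mapMatrix G)
      (H := (mapRingHom (MvPolynomial.eval y)).mapMatrix Q) (D := D) (M' := M') (B := D * n + N)
      (by rw [← map_mul, hGQ, map_one])
      (fun p q => natDegree_map_le.trans (hD p q))
      (fun p q => natDegree_map_le.trans ((hM₀ p q).trans (by omega))) (by omega) (by omega)]
    refine sum_congr rfl fun I _ => ?_
    rw [MvPolynomial.smul_eval, RingHom.map_det]
    congr 2
    ext a b
    exact (act_map_single (MvPolynomial.eval y) G _ _).symm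
  -- Over `R`, `Q` becomes `∏ (1 - x_i u⁻¹)`, which sends `H(u⁻¹) e_{b+1}` to `e_{b+1}`; its
  -- inverse, the image of `G`, therefore has these columns.
  have hcol : ∀ (b : Fin (M' * n)) (i : ℤ), φ (W b i) = coeffZ H ((b : ℤ) + 1 - i) := by
    intro b i
    have h1 := (act_map_single (φ : MvPolynomial R K →+* R) G ((b : ℤ) + 1) i).symm
    have h2 : act (aeval (rootMatrix n R) (∏ i, (1 - C (x i) * X)))
        (fun i => coeffZ H ((b : ℤ) + 1 - i)) = Pi.single ((b : ℤ) + 1) 1 := by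
      rw [act_aeval_rootMatrix, aeval_shiftOne_coeffZ, hH, coeffZ_one]
    rw [← h2, ← Module.End.mul_apply, ← hQ, ← map_mul, ← map_mul, hGQ, map_one, map_one] at h1
    exact h1
  have h0 : φ q = 0 := by rw [hq, map_zero]
  rw [map_sum] at h0
  rw [← h0]
  refine sum_congr rfl fun I _ => ?_
  rw [map_smul, AlgHom.map_det]
  congr 2
  ext a b
  exact (hcol b (I.1 a)).symm

end AffGr

end

noncomputable section

namespace AffGr

open Finset

/-! ### Complete symmetric functions and the Jacobi-Trudi formula -/

section JacobiTrudi

variable (m : ℕ) (K : Type*) [Field K]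

/-- The generating series of the complete symmetric functions in `m` variables. -/
def completeSeries : (MvPolynomial (Fin m) K)⟦X⟧ :=
  ∏ i, PowerSeries.mk fun k => (MvPolynomial.X i : MvPolynomial (Fin m) K) ^ k

variable {m K}

theorem one_sub_mul_mk_pow {A : Type*} [CommRing A] (x : A) :
    (((1 - Polynomial.C x * Polynomial.X : Polynomial A)) : A⟦X⟧) *
      PowerSeries.mk (fun k => x ^ k) = 1 := by
  ext k
  rw [Polynomial.coe_sub, Polynomial.coe_one, Polynomial.coe_mul, Polynomial.coe_C,
    Polynomial.coe_X, sub_mul, one_mul, map_sub, PowerSeries.coeff_mk, mul_assoc,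
    PowerSeries.coeff_C_mul]
  cases k with
  | zero => simp
  | succ k =>
    rw [PowerSeries.coeff_succ_X_mul, PowerSeries.coeff_mk, PowerSeries.coeff_one]
    simp [pow_succ']

theorem prod_one_sub_mul_completeSeries :
    ((∏ i, (1 - Polynomial.C (MvPolynomial.X i) * Polynomial.X) :
      Polynomial (MvPolynomial (Fin m) K)) : (MvPolynomial (Fin m) K)⟦X⟧) *
      completeSeries m K = 1 := by
  rw [completeSeries, ← Polynomial.coeToPowerSeries.ringHom_apply, map_prod, ← prod_mul_distrib]
  exact prod_eq_one fun i _ => one_sub_mul_mk_pow _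

theorem prod_erase_mul_completeSeries (p : Fin m) :
    ((∏ i ∈ univ.erase p, (1 - Polynomial.C (MvPolynomial.X i) * Polynomial.X) :
      Polynomial (MvPolynomial (Fin m) K)) : (MvPolynomial (Fin m) K)⟦X⟧) *
      completeSeries m K = PowerSeries.mk fun k => (MvPolynomial.X p) ^ k := by
  rw [completeSeries, ← Polynomial.coeToPowerSeries.ringHom_apply, map_prod,
    ← mul_prod_erase univ _ (mem_univ p), mul_left_comm, ← prod_mul_distrib]
  rw [prod_eq_one fun i _ => one_sub_mul_mk_pow _, mul_one]

theorem isHomogeneous_coeff_completeSeries (k : ℕ) :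
    (PowerSeries.coeff k (completeSeries m K)).IsHomogeneous k := by
  rw [completeSeries]
  induction (univ : Finset (Fin m)) using Finset.induction_on generalizing k with
  | empty =>
    rw [prod_empty, PowerSeries.coeff_one]
    split_ifs with h
    · exact h ▸ MvPolynomial.isHomogeneous_one _ _
    · exact MvPolynomial.isHomogeneous_zero _ _ _
  | insert i s his ih =>
    rw [prod_insert his, PowerSeries.coeff_mul]
    refine MvPolynomial.IsHomogeneous.sum _ _ _ fun q hq => ?_
    rw [← mem_antidiagonal.1 hq, PowerSeries.coeff_mk]
    exact (MvPolynomial.isHomogeneous_X_pow _ _).mul (ih _)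

theorem rename_coeff_completeSeries (σ : Equiv.Perm (Fin m)) (k : ℕ) :
    MvPolynomial.rename σ (PowerSeries.coeff k (completeSeries m K)) =
      PowerSeries.coeff k (completeSeries m K) := by
  have h : PowerSeries.map (MvPolynomial.rename σ : _ →ₐ[K] MvPolynomial (Fin m) K).toRingHom
      (completeSeries m K) = completeSeries m K := by
    rw [completeSeries, map_prod]
    refine Fintype.prod_equiv σ _ _ fun i => ?_
    ext k : 1
    simp
  conv_rhs => rw [← h, PowerSeries.coeff_map]
  rfl

/-- The Schur function of the sequence `k`, as a determinant of complete symmetric functions. -/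
def schur (m : ℕ) (K : Type*) [Field K] (M : ℕ) (k : ℕ → ℤ) : MvPolynomial (Fin m) K :=
  (Matrix.of fun a b : Fin M => coeffZ (completeSeries m K) ((b : ℤ) + 1 - k a)).det

theorem constantCoeff_completeSeries :
    PowerSeries.coeff 0 (completeSeries m K) = 1 := by
  rw [completeSeries, PowerSeries.coeff_zero_eq_constantCoeff, map_prod]
  refine prod_eq_one fun i _ => ?_
  rw [← PowerSeries.coeff_zero_eq_constantCoeff_apply, PowerSeries.coeff_mk, pow_zero]

/-- A natural entry in the last position gives the last row `0, …, 0, h_0` with `h_0 = 1`. -/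
theorem schur_eq_of_natural {M N : ℕ} {k : ℕ → ℤ} (hk : ∀ j, M ≤ j → k j = j + 1) (hMN : M ≤ N) :
    schur m K N k = schur m K M k := by
  induction N, hMN using Nat.le_induction with
  | base => rfl
  | succ N hN ih =>
    rw [← ih, schur, ← Matrix.det_transpose, det_eq_of_last_column, schur, ← Matrix.det_transpose]
    · rfl
    · intro a
      have := a.2
      simp only [Matrix.transpose_apply, Matrix.of_apply, coeffZ, Fin.val_castSucc, Fin.val_last]
      rw [hk N hN, if_neg (by omega)]
    · simp only [Matrix.transpose_apply, Matrix.of_apply, coeffZ, Fin.val_last]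
      rw [hk N hN, if_pos (by omega), sub_self]
      exact constantCoeff_completeSeries

/-- A Leibniz term without negative indices has degree `∑ (a + 1 - i_{σ a})`, which is independent
of `σ`. -/
theorem isHomogeneous_schur {M : ℕ} {I : Idx} (hI : I.Natural M) :
    (schur m K M I.1).IsHomogeneous I.deg := by
  rw [schur, Matrix.det_apply]
  refine MvPolynomial.IsHomogeneous.sum _ _ _ fun σ _ => ?_
  rw [Units.smul_def, zsmul_eq_mul]
  rw [← zero_add I.deg]
  refine MvPolynomial.IsHomogeneous.mul ?_ ?_
  · have := MvPolynomial.isHomogeneous_C (Fin m) (((Equiv.Perm.sign σ : ℤˣ) : ℤ) : K)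
    simpa using this
  · by_cases h : ∀ a : Fin M, 0 ≤ (a : ℤ) + 1 - I.1 (σ a)
    · have hd : I.deg = ∑ a : Fin M, ((a : ℤ) + 1 - I.1 (σ a)).toNat := by
        have h1 := Idx.coe_deg hI
        have h2 : ((∑ a : Fin M, ((a : ℤ) + 1 - I.1 (σ a)).toNat : ℕ) : ℤ) =
            ∑ a : Fin M, ((a : ℤ) + 1 - I.1 (σ a)) := by
          rw [Nat.cast_sum]
          exact sum_congr rfl fun a _ => Int.toNat_of_nonneg (h a)
        rw [sum_sub_distrib, Equiv.sum_comp σ fun a : Fin M => I.1 a] at h2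
        rw [Finset.sum_range, sum_sub_distrib] at h1
        exact_mod_cast h1.trans h2.symm
      rw [hd]
      refine MvPolynomial.IsHomogeneous.prod _ _ _ fun a _ => ?_
      rw [Matrix.of_apply, coeffZ, if_pos (h a)]
      exact isHomogeneous_coeff_completeSeries _
    · push Not at h
      obtain ⟨a, ha⟩ := h
      rw [prod_eq_zero (mem_univ a)]
      · exact MvPolynomial.isHomogeneous_zero _ _ _
      · rw [Matrix.of_apply, coeffZ, if_neg (by omega)]

theorem rename_schur (σ : Equiv.Perm (Fin m)) (M : ℕ) (k : ℕ → ℤ) :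
    MvPolynomial.rename σ (schur m K M k) = schur m K M k := by
  rw [schur, AlgHom.map_det]
  congr 1
  ext1 a b
  simp only [AlgHom.mapMatrix_apply, Matrix.map_apply, Matrix.of_apply, coeffZ]
  split_ifs
  · exact rename_coeff_completeSeries σ _
  · exact map_zero _

/-! ### Alternants -/

variable (m K) in
/-- Antisymmetrization of polynomials. -/
def antisymm : MvPolynomial (Fin m) K →ₗ[K] MvPolynomial (Fin m) K :=
  ∑ σ : Equiv.Perm (Fin m), (((Equiv.Perm.sign σ : ℤˣ) : ℤ) : K) •
    (MvPolynomial.rename σ : _ →ₐ[K] MvPolynomial (Fin m) K).toLinearMap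

theorem antisymm_apply (q : MvPolynomial (Fin m) K) :
    antisymm m K q = ∑ σ : Equiv.Perm (Fin m),
      (((Equiv.Perm.sign σ : ℤˣ) : ℤ) : K) • MvPolynomial.rename σ q := by
  simp [antisymm]

theorem antisymm_mul {s : MvPolynomial (Fin m) K}
    (hs : ∀ σ : Equiv.Perm (Fin m), MvPolynomial.rename σ s = s) (q : MvPolynomial (Fin m) K) :
    antisymm m K (s * q) = s * antisymm m K q := by
  rw [antisymm_apply, antisymm_apply, mul_sum]
  refine sum_congr rfl fun σ _ => ?_
  rw [map_mul, hs, mul_smul_comm]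

/-- The monomial with exponents `α`. -/
def mono (K : Type*) [Field K] {m : ℕ} (α : Fin m → ℕ) : MvPolynomial (Fin m) K :=
  ∏ q, MvPolynomial.X q ^ α q

theorem mono_eq_monomial (α : Fin m → ℕ) :
    mono K α = MvPolynomial.monomial (Finsupp.equivFunOnFinite.symm α) 1 := by
  rw [MvPolynomial.monomial_eq, map_one, one_mul, Finsupp.prod_fintype _ _ (by simp)]
  rfl

theorem mono_mul (α β : Fin m → ℕ) : mono K α * mono K β = mono K (α + β) := by
  simp [mono, ← prod_mul_distrib, pow_add]

theorem rename_mono (σ : Equiv.Perm (Fin m)) (α : Fin m → ℕ) :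
    MvPolynomial.rename σ (mono K α) = mono K (α ∘ σ.symm) := by
  rw [mono, map_prod]
  refine Fintype.prod_equiv σ _ _ fun i => ?_
  simp

theorem antisymm_mono_eq_det (α : Fin m → ℕ) :
    antisymm m K (mono K α) =
      (Matrix.of fun p q : Fin m => (MvPolynomial.X p : MvPolynomial (Fin m) K) ^ α q).det := by
  rw [antisymm_apply, Matrix.det_apply]
  refine sum_congr rfl fun σ _ => ?_
  rw [mono, map_prod, Units.smul_def, ← Int.cast_smul_eq_zsmul K]
  congr 1
  refine prod_congr rfl fun q _ => ?_
  simp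

theorem coeff_antisymm_mono (α β : Fin m → ℕ) :
    MvPolynomial.coeff (Finsupp.equivFunOnFinite.symm β) (antisymm m K (mono K α)) =
      ∑ σ : Equiv.Perm (Fin m), if ∀ a, α a = β (σ a) then
        (((Equiv.Perm.sign σ : ℤˣ) : ℤ) : K) else 0 := by
  classical
  rw [antisymm_apply, MvPolynomial.coeff_sum]
  refine sum_congr rfl fun σ _ => ?_
  rw [MvPolynomial.coeff_smul, rename_mono, mono_eq_monomial, MvPolynomial.coeff_monomial,
    smul_eq_mul, mul_ite, mul_one, mul_zero]
  refine if_congr ((Equiv.apply_eq_iff_eq _).trans ⟨fun h a => ?_, fun h => ?_⟩) rfl rfl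
  · rw [← h]
    simp
  · funext a
    simp [h]

/-- The exponents attached to a sequence bounded by `m`. -/
def expo (m : ℕ) (k : ℕ → ℤ) (q : Fin m) : ℕ := ((m : ℤ) - k q).toNat

/-- Under `k ↦ m - k` an alternant corresponds to an alternating symbol; both sides are the same sum
over permutations. -/
theorem coeff_antisymm_mono_expo {k : ℕ → ℤ} {L : Idx} (hk : ∀ j, m ≤ j → k j = j + 1)
    (hle : ∀ a : Fin m, k a ≤ m) (hL : L.Natural m) :
    MvPolynomial.coeff (Finsupp.equivFunOnFinite.symm (expo m L.1))
      (antisymm m K (mono K (expo m k))) = pluckerSeq K k (Finsupp.single L 1) := by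
  rw [coeff_antisymm_mono, pluckerSeq_single_eq_sum hk hL]
  refine sum_congr rfl fun σ _ => if_congr (forall_congr' fun a => ?_) rfl rfl
  have h1 := hle a
  have h2 := L.apply_le (σ a)
  have h3 := (σ a).2
  simp only [expo]
  omega

/-- The matrix of elementary symmetric functions in all variables but one. -/
def elemMatrix (m : ℕ) (K : Type*) [Field K] :
    Matrix (Fin m) (Fin m) (MvPolynomial (Fin m) K) :=
  Matrix.of fun p b => (∏ i ∈ univ.erase p, (1 - Polynomial.C (MvPolynomial.X i) *
    Polynomial.X) : Polynomial (MvPolynomial (Fin m) K)).coeff (m - 1 - b)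

/-- Multiplying the complete series by all factors `1 - x_i X` except the `p`-th leaves `(1 - x_p
X)⁻¹`. Comparing coefficients factors the alternant matrix, with a left factor independent of `k`,
whose determinant is found from the natural sequence. -/
theorem det_pow_expo {k : ℕ → ℤ} (hle : ∀ a : Fin m, k a ≤ m) :
    antisymm m K (mono K (expo m k)) = (elemMatrix m K).det * schur m K m k := by
  rw [antisymm_mono_eq_det, schur, ← Matrix.det_transpose (Matrix.of fun a b : Fin m => coeffZ _ _),
    ← Matrix.det_mul]
  congr 1
  ext1 p q
  rw [Matrix.mul_apply, Matrix.of_apply]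
  set P : Polynomial (MvPolynomial (Fin m) K) :=
    ∏ i ∈ univ.erase p, (1 - Polynomial.C (MvPolynomial.X i) * Polynomial.X) with hP
  have hm : m - 1 + 1 = m := by have := p.2; omega
  have hdeg : P.natDegree ≤ m - 1 := by
    refine (Polynomial.natDegree_prod_le _ _).trans ?_
    refine (sum_le_card_nsmul _ _ 1 fun i _ => ?_).trans (by simp)
    compute_degree
  have h1 := congrFun (aeval_shiftOne_coeffZ P (completeSeries m K) ((m : ℤ) - k q)) 0
  rw [aeval_shiftOne_apply P hdeg, hP, prod_erase_mul_completeSeries, ← hP, hm] at h1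
  have h2 : coeffZ (PowerSeries.mk fun j => (MvPolynomial.X p : MvPolynomial (Fin m) K) ^ j)
      ((m : ℤ) - k q - 0) = MvPolynomial.X p ^ expo m k q := by
    have := hle q
    rw [coeffZ, if_pos (by omega), PowerSeries.coeff_mk, sub_zero]
    rfl
  rw [← h2, ← h1, Finset.sum_range, ← Equiv.sum_comp Fin.revPerm]
  refine sum_congr rfl fun b _ => ?_
  have hb := b.2
  simp only [Fin.revPerm_apply, Fin.val_rev, elemMatrix, Matrix.of_apply, Matrix.transpose_apply]
  congr 2
  · omega
  · push_cast [Nat.cast_sub (show (b : ℕ) + 1 ≤ m from hb)]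
    ring

theorem det_elemMatrix :
    (elemMatrix m K).det = antisymm m K (mono K (expo m fun j => (j : ℤ) + 1)) := by
  have h : schur m K 0 (fun j => (j : ℤ) + 1) = 1 := Matrix.det_isEmpty
  rw [det_pow_expo fun a => by have := a.2; omega, schur_eq_of_natural (M := 0) (fun _ _ => rfl)
    (Nat.zero_le m), h, mul_one]

/-- The Jacobi-Trudi formula. -/
theorem schur_mul_antisymm {k : ℕ → ℤ} (hle : ∀ a : Fin m, k a ≤ m) :
    schur m K m k * antisymm m K (mono K (expo m fun j => (j : ℤ) + 1)) =
      antisymm m K (mono K (expo m k)) := by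
  rw [← det_elemMatrix, mul_comm, ← det_pow_expo hle]

end JacobiTrudi

end AffGr

end

noncomputable section

namespace AffGr

open Finset

/-! ### From symmetric functions to linear forms -/

section Straighten

variable {m : ℕ} {K : Type*} [Field K]

variable (m K) in
/-- The linear form of degree `m` with the coefficients of the antisymmetrization of `x ^ δ q`. -/
def straighten : MvPolynomial (Fin m) K →ₗ[K] LinForm K where
  toFun q := Finsupp.linearCombination K fun L : Idx => if L.deg = m then
    MvPolynomial.coeff (Finsupp.equivFunOnFinite.symm (expo m L.1))
      (antisymm m K (mono K (expo m fun j => (j : ℤ) + 1) * q)) else 0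
  map_add' p q := by
    refine LinForm.ext fun L => ?_
    rw [LinearMap.add_apply]
    simp only [Finsupp.linearCombination_single, mul_add, map_add, MvPolynomial.coeff_add, one_smul]
    split_ifs <;> simp
  map_smul' c q := by
    refine LinForm.ext fun L => ?_
    rw [LinearMap.smul_apply]
    simp only [Finsupp.linearCombination_single, mul_smul_comm, map_smul, MvPolynomial.coeff_smul,
      one_smul, RingHom.id_apply]
    split_ifs <;> simp

theorem straighten_single (q : MvPolynomial (Fin m) K) (L : Idx) :
    straighten m K q (Finsupp.single L 1) = if L.deg = m then
      MvPolynomial.coeff (Finsupp.equivFunOnFinite.symm (expo m L.1))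
        (antisymm m K (mono K (expo m fun j => (j : ℤ) + 1) * q)) else 0 := by
  simp [straighten]

theorem isHomogeneous_antisymm_mono (α : Fin m → ℕ) :
    (antisymm m K (mono K α)).IsHomogeneous (∑ q, α q) := by
  rw [antisymm_apply]
  refine MvPolynomial.IsHomogeneous.sum _ _ _ fun σ _ => ?_
  refine (MvPolynomial.homogeneousSubmodule (Fin m) K _).smul_mem _ ?_
  rw [rename_mono, ← Equiv.sum_comp σ.symm α]
  exact MvPolynomial.IsHomogeneous.prod _ _ _ fun i _ => MvPolynomial.isHomogeneous_X_pow _ _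

theorem sum_expo {L : Idx} (hL : L.Natural m) :
    ∑ q, expo m L.1 q = L.deg + ∑ q, expo m (fun j => (j : ℤ) + 1) q := by
  have h1 := Idx.coe_deg hL
  rw [Finset.sum_range] at h1
  zify
  rw [h1, ← sum_add_distrib]
  refine sum_congr rfl fun q _ => ?_
  have h2 := L.apply_le q
  have h3 := q.2
  simp only [expo]
  omega

/-- By Jacobi-Trudi, `a_δ s_I` is the alternant of `I`, in which `I` alone among increasing
sequences has a non-zero coefficient. With `m` variables every `I` of degree `m` fits; other degrees
drop out by homogeneity. -/
theorem straighten_schur {M : ℕ} (hmM : m ≤ M) {I : Idx} (hI : I.Natural M) :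
    straighten m K (schur m K M I.1) = if I.deg = m then plucker K I else 0 := by
  classical
  refine LinForm.ext fun L => ?_
  rw [straighten_single, mul_comm, antisymm_mul fun σ => rename_schur σ M I.1]
  by_cases hL : L.deg = m
  · have hLm : L.Natural m := hL ▸ L.natural_deg
    rw [if_pos hL]
    split_ifs with hd
    · have hIm : I.Natural m := hd ▸ I.natural_deg
      have hle : ∀ a : Fin m, I.1 a ≤ m := fun a => (I.apply_le a).trans (by have := a.2; omega)
      rw [schur_eq_of_natural hIm hmM, schur_mul_antisymm hle,
        coeff_antisymm_mono_expo hIm hle hLm, pluckerSeq_of_perm hIm hIm 1 fun _ => rfl]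
      simp
    · rw [LinearMap.zero_apply]
      refine ((isHomogeneous_schur hI).mul (isHomogeneous_antisymm_mono _)).coeff_eq_zero ?_
      rw [Finsupp.degree_eq_sum]
      simp only [Finsupp.equivFunOnFinite_symm_apply_apply]
      rw [sum_expo hLm, hL]
      omega
  · rw [if_neg hL]
    split_ifs with hd
    · rw [plucker_single, if_neg]
      rintro rfl
      exact hL hd
    · rfl

/-- The elementary symmetric functions of the `n`-th powers of the variables. -/
def powerElem (m : ℕ) (K : Type*) [Field K] (n ℓ : ℕ) : MvPolynomial (Fin m) K :=
  MvPolynomial.expand n (MvPolynomial.esymm (Fin m) K ℓ)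

theorem rename_powerElem (n ℓ : ℕ) (σ : Equiv.Perm (Fin m)) :
    MvPolynomial.rename σ (powerElem m K n ℓ) = powerElem m K n ℓ := by
  rw [powerElem, MvPolynomial.rename_expand, MvPolynomial.rename_esymm]

theorem powerElem_eq_sum (n ℓ : ℕ) :
    powerElem m K n ℓ = ∑ s ∈ powersetCard ℓ univ, ∏ i ∈ s, MvPolynomial.X i ^ n := by
  simp [powerElem, MvPolynomial.esymm]

theorem expo_lower {n : ℕ} {I : Idx} (s : Finset (Fin m)) (q : Fin m) :
    expo m (lower n I (s.map Fin.valEmbedding)) q = expo m I.1 q + if q ∈ s then n else 0 := by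
  have hmem : (q : ℕ) ∈ s.map Fin.valEmbedding ↔ q ∈ s := Finset.mem_map' Fin.valEmbedding
  have h1 := I.apply_le q
  have h2 := q.2
  simp only [expo, lower, hmem]
  split_ifs <;> omega

/-- Raising `ℓ` exponents `m - i_a` by `n` is lowering `ℓ` entries of `I` by `n`. -/
theorem coeff_antisymm_powerElem_mul {n : ℕ} (hn : 1 ≤ n) (ℓ : ℕ) {I L : Idx} (hI : I.Natural m)
    (hL : L.Natural m) :
    MvPolynomial.coeff (Finsupp.equivFunOnFinite.symm (expo m L.1))
      (antisymm m K (powerElem m K n ℓ * mono K (expo m I.1))) =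
      shuffle K n I ℓ (Finsupp.single L 1) := by
  rw [shuffle_single hn ℓ hI hL, sum_powersetCard_range, powerElem_eq_sum, sum_mul, map_sum,
    MvPolynomial.coeff_sum]
  refine sum_congr rfl fun s _ => ?_
  have hs : s.map Fin.valEmbedding ⊆ range m := fun x hx => by
    simp only [mem_map, Fin.valEmbedding_apply] at hx
    obtain ⟨a, -, rfl⟩ := hx
    simp
  rw [← coeff_antisymm_mono_expo (lower_natural hI hs) (fun a => ?_) hL]
  · congr 2
    simp only [mono, expo_lower, pow_add, prod_mul_distrib]
    rw [mul_comm]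
    congr 1
    rw [← prod_subset (subset_univ s) fun i _ hi => by simp [hi]]
    exact prod_congr rfl fun i hi => by simp [hi]
  · have h1 := I.apply_le a
    have h2 := a.2
    simp only [lower]
    split_ifs <;> omega

variable (K) in
/-- The span of the shuffles of degree `d`. -/
def shuffleSpan (n d : ℕ) : Submodule K (LinForm K) :=
  Submodule.span K ((fun q : Idx × ℕ+ => shuffle K n q.1 q.2) '' {q | q.1.deg + n * q.2 = d})

/-- The symmetric factor comes out of the antisymmetrization, leaving the alternant of `x^{δ+β}`.
This is zero if an exponent repeats; otherwise it is, up to sign, the alternant of some `I`, and the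
result is `± sh_{I,ℓ}` or zero according to degree. -/
theorem straighten_powerElem_mul_mono {n : ℕ} (hn : 1 ≤ n) (ℓ : ℕ+) (β : Fin m → ℕ) :
    straighten m K (powerElem m K n ℓ * mono K β) ∈ shuffleSpan K n m := by
  set γ := expo m (fun j => (j : ℤ) + 1) + β with hγ
  have hst : ∀ L : Idx, straighten m K (powerElem m K n ℓ * mono K β) (Finsupp.single L 1) =
      if L.deg = m then MvPolynomial.coeff (Finsupp.equivFunOnFinite.symm (expo m L.1))
        (powerElem m K n ℓ * antisymm m K (mono K γ)) else 0 := by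
    intro L
    rw [straighten_single, mul_left_comm, mono_mul, antisymm_mul fun σ => rename_powerElem n ℓ σ]
  by_cases hinj : Function.Injective γ
  · obtain ⟨I, hI, σ, hσ⟩ := exists_sort (k := fun a => (m : ℤ) - γ a)
      (fun a b hab => hinj (by simpa using hab)) (fun a => by simp)
    have hγI : γ = expo m I.1 ∘ σ := by
      funext a
      have h : (m : ℤ) - γ a = I.1 (σ a) := hσ a
      change γ a = ((m : ℤ) - I.1 (σ a)).toNat
      omega
    have hanti : antisymm m K (mono K γ) =
        (((Equiv.Perm.sign σ : ℤˣ) : ℤ) : K) • antisymm m K (mono K (expo m I.1)) := by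
      rw [antisymm_mono_eq_det, antisymm_mono_eq_det, hγI, MvPolynomial.smul_eq_C_mul]
      have := Matrix.det_permute' σ (Matrix.of fun p q : Fin m =>
        (MvPolynomial.X p : MvPolynomial (Fin m) K) ^ expo m I.1 q)
      rw [map_intCast]
      exact this
    have hval : ∀ L : Idx, straighten m K (powerElem m K n ℓ * mono K β) (Finsupp.single L 1) =
        if L.deg = m then (((Equiv.Perm.sign σ : ℤˣ) : ℤ) : K) *
          shuffle K n I ℓ (Finsupp.single L 1) else 0 := by
      intro L
      rw [hst]
      split_ifs with hL
      · rw [hanti, mul_smul_comm, MvPolynomial.coeff_smul,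
          ← antisymm_mul fun σ => rename_powerElem n ℓ σ,
          coeff_antisymm_powerElem_mul hn ℓ hI (hL ▸ L.natural_deg), smul_eq_mul]
      · rfl
    by_cases hd : I.deg + n * ℓ = m
    · have : straighten m K (powerElem m K n ℓ * mono K β) =
          (((Equiv.Perm.sign σ : ℤˣ) : ℤ) : K) • shuffle K n I ℓ := by
        refine LinForm.ext fun L => ?_
        rw [hval, LinearMap.smul_apply, smul_eq_mul]
        split_ifs with hL
        · rfl
        · by_contra hne
          exact hL ((deg_eq_of_shuffle hn (right_ne_zero_of_mul (Ne.symm hne))).trans hd)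
      rw [this]
      exact Submodule.smul_mem _ _ (Submodule.subset_span ⟨(I, ℓ), hd, rfl⟩)
    · have : straighten m K (powerElem m K n ℓ * mono K β) = 0 := by
        refine LinForm.ext fun L => ?_
        rw [hval, LinearMap.zero_apply]
        split_ifs with hL
        · by_contra hne
          exact hd ((deg_eq_of_shuffle hn (right_ne_zero_of_mul hne)).symm.trans hL)
        · rfl
      rw [this]
      exact Submodule.zero_mem _
  · have h0 : antisymm m K (mono K γ) = 0 := by
      simp only [Function.Injective, not_forall] at hinj
      obtain ⟨a, b, hab, hne⟩ := hinj
      rw [antisymm_mono_eq_det]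
      exact Matrix.det_zero_of_column_eq hne fun p => by simp [hab]
    have : straighten m K (powerElem m K n ℓ * mono K β) = 0 := by
      refine LinForm.ext fun L => ?_
      rw [hst, h0, mul_zero, MvPolynomial.coeff_zero, ite_self, LinearMap.zero_apply]
    rw [this]
    exact Submodule.zero_mem _

variable (m K) in
/-- The ideal generated by the elementary symmetric functions of the `n`-th powers. -/
def powerElemIdeal (n : ℕ) : Ideal (MvPolynomial (Fin m) K) :=
  Ideal.span (Set.range fun ℓ : ℕ+ => powerElem m K n ℓ)

theorem straighten_mul_powerElem {n : ℕ} (hn : 1 ≤ n) (ℓ : ℕ+) (r : MvPolynomial (Fin m) K) :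
    straighten m K (r * powerElem m K n ℓ) ∈ shuffleSpan K n m := by
  induction r using MvPolynomial.induction_on' with
  | monomial u a =>
    have : MvPolynomial.monomial u a = a • mono K u := by
      rw [mono_eq_monomial, MvPolynomial.smul_monomial, smul_eq_mul, mul_one,
        show Finsupp.equivFunOnFinite.symm ⇑u = u from Equiv.symm_apply_apply _ u]
    rw [this, mul_comm, mul_smul_comm, map_smul]
    exact Submodule.smul_mem _ _ (straighten_powerElem_mul_mono hn ℓ _)
  | add p q hp hq =>
    rw [add_mul, map_add]
    exact Submodule.add_mem _ hp hq

theorem straighten_mem_shuffleSpan {n : ℕ} (hn : 1 ≤ n) {q : MvPolynomial (Fin m) K}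
    (hq : q ∈ powerElemIdeal m K n) : straighten m K q ∈ shuffleSpan K n m := by
  suffices h : ∀ r, straighten m K (r * q) ∈ shuffleSpan K n m by simpa using h 1
  induction hq using Submodule.span_induction with
  | mem x hx =>
    obtain ⟨ℓ, rfl⟩ := hx
    exact straighten_mul_powerElem hn ℓ
  | zero => simp
  | add x y _ _ hx hy =>
    intro r
    rw [mul_add, map_add]
    exact Submodule.add_mem _ (hx r) (hy r)
  | smul a x _ hx =>
    intro r
    rw [smul_eq_mul, ← mul_assoc]
    exact hx _

/-! ### The relations in the quotient by the elementary symmetric functions of the powers -/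

theorem prod_one_sub_pow_mul_X_eq_one {R ι : Type*} [CommRing R] [Fintype ι] {n : ℕ} (x : ι → R)
    (h : ∀ ℓ, 1 ≤ ℓ → ∑ s ∈ powersetCard ℓ univ, ∏ i ∈ s, x i ^ n = 0) :
    ∏ i, (1 - Polynomial.C (x i) ^ n * Polynomial.X : Polynomial R) = 1 := by
  classical
  have h1 : ∀ ℓ : ℕ, ∑ s ∈ powersetCard ℓ (univ : Finset ι),
      ∏ i ∈ s, (-(Polynomial.C (x i) ^ n * Polynomial.X)) =
      Polynomial.C (∑ s ∈ powersetCard ℓ univ, ∏ i ∈ s, x i ^ n) * (-Polynomial.X) ^ ℓ := by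
    intro ℓ
    rw [map_sum, sum_mul]
    refine sum_congr rfl fun s hs => ?_
    rw [map_prod, ← (mem_powersetCard.1 hs).2, ← prod_const, ← prod_mul_distrib]
    exact prod_congr rfl fun i _ => by simp
  simp_rw [sub_eq_add_neg]
  rw [prod_one_add, sum_powerset, sum_range_succ', sum_eq_zero]
  · simp
  · intro ℓ _
    rw [h1, h _ ℓ.succ_pos, map_zero, zero_mul]

theorem prod_one_sub_pow_eq_one (n : ℕ) :
    ∏ i, (1 - Polynomial.C (Ideal.Quotient.mk (powerElemIdeal m K n) (MvPolynomial.X i)) ^ n *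
      Polynomial.X) = 1 := by
  refine prod_one_sub_pow_mul_X_eq_one _ fun ℓ hℓ => ?_
  have h := Ideal.Quotient.eq_zero_iff_mem.2
    (show powerElem m K n ℓ ∈ powerElemIdeal m K n from Ideal.subset_span ⟨⟨ℓ, hℓ⟩, rfl⟩)
  rw [powerElem_eq_sum, map_sum] at h
  rw [← h]
  exact sum_congr rfl fun s _ => by simp

end Straighten

/-- Each factor is a unit of `R[X]`, so its coefficient of `X`, which is `-x_i^n`, is nilpotent. -/
theorem isNilpotent_of_prod_eq_one {R ι : Type*} [CommRing R] [Fintype ι] {n : ℕ} {x : ι → R}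
    (h : ∏ i, (1 - Polynomial.C (x i) ^ n * Polynomial.X : Polynomial R) = 1) (i : ι) :
    IsNilpotent (x i) := by
  classical
  rw [← mul_prod_erase univ _ (mem_univ i)] at h
  have h1 := (Polynomial.isUnit_iff_coeff_isUnit_isNilpotent.1 (IsUnit.of_mul_eq_one _ h)).2 1
    one_ne_zero
  rw [← map_pow, Polynomial.coeff_sub, Polynomial.coeff_C_mul_X, Polynomial.coeff_one] at h1
  simp only [one_ne_zero, if_true, if_false, zero_sub, isNilpotent_neg_iff] at h1
  exact h1.of_pow

/-! ### The linear relations of the affine Grassmannian -/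

variable {K : Type*} [Field K] {n : ℕ}

/-- The homogeneous component of degree `d` of a linear form. -/
def component (f : LinForm K) (d : ℕ) : LinForm K :=
  Finsupp.linearCombination K fun L : Idx => if L.deg = d then f (Finsupp.single L 1) else 0

theorem component_single (f : LinForm K) (d : ℕ) (L : Idx) :
    component f d (Finsupp.single L 1) = if L.deg = d then f (Finsupp.single L 1) else 0 := by
  simp [component]

theorem component_mem_shuffleSpan [IsAlgClosed K] (hn : 1 ≤ n) {f : LinForm K}
    (hf : f ∈ linearIdeal (affGr₀ K n)) (m : ℕ) : component f m ∈ shuffleSpan K n m := by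
  classical
  have : NeZero n := ⟨by omega⟩
  set π := Ideal.Quotient.mk (powerElemIdeal m K n)
  have hprod := prod_one_sub_pow_eq_one (m := m) (K := K) n
  have hH := congrArg (PowerSeries.map π) (prod_one_sub_mul_completeSeries (m := m) (K := K))
  rw [map_mul, map_one, ← Polynomial.polynomial_map_coe, Polynomial.map_prod] at hH
  simp only [Polynomial.map_sub, Polynomial.map_one, Polynomial.map_mul, Polynomial.map_C,
    Polynomial.map_X] at hH
  -- Requiring `M, B ≥ m` ensures that the finite index set contains every `L` of degree `m`.
  obtain ⟨M, B, hM, hB, hsum⟩ := sum_det_coeffZ_eq_zero hf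
    (fun i => π (MvPolynomial.X i)) (isNilpotent_of_prod_eq_one hprod) hprod _ hH m
  set Q : MvPolynomial (Fin m) K :=
    ∑ I ∈ boundedIdx M B, f (Finsupp.single I 1) • schur m K M I.1 with hQ
  have hQJ : Q ∈ powerElemIdeal m K n := by
    rw [← Ideal.Quotient.eq_zero_iff_mem, ← hsum, hQ, map_sum]
    refine sum_congr rfl fun I _ => ?_
    have hs : ∀ (c : K) (q : MvPolynomial (Fin m) K), π (c • q) = c • π q := fun _ _ => rfl
    rw [hs, schur, RingHom.map_det]
    congr 2
    ext1 a b
    simp only [RingHom.mapMatrix_apply, Matrix.map_apply, Matrix.of_apply, coeffZ,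
      PowerSeries.coeff_map]
    split_ifs <;> simp
  have hcomp : component f m = straighten m K Q := by
    refine LinForm.ext fun L => ?_
    rw [component_single, hQ, map_sum, LinearMap.sum_apply]
    have hterm : ∀ I ∈ boundedIdx M B, straighten m K (f (Finsupp.single I 1) • schur m K M I.1)
        (Finsupp.single L 1) = if I = L then (if L.deg = m then f (Finsupp.single L 1) else 0)
          else 0 := by
      intro I hI
      rw [map_smul, straighten_schur hM (mem_boundedIdx.1 hI).1, LinearMap.smul_apply, smul_eq_mul]
      by_cases hIL : I = L
      · subst hIL
        rw [if_pos rfl]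
        split_ifs
        · rw [plucker_single, if_pos rfl, mul_one]
        · rw [LinearMap.zero_apply, mul_zero]
      · rw [if_neg hIL]
        split_ifs
        · rw [plucker_single, if_neg hIL, mul_zero]
        · rw [LinearMap.zero_apply, mul_zero]
    rw [sum_congr rfl hterm, sum_ite_eq' (boundedIdx M B) L]
    by_cases hL : L.deg = m
    · rw [if_pos hL, if_pos]
      refine mem_boundedIdx.2 ⟨L.natural_deg.mono (by omega), ?_⟩
      have := L.sub_deg_le 0
      push_cast at this
      omega
    · rw [if_neg hL, ite_self]
  rw [hcomp]
  exact straighten_mem_shuffleSpan hn hQJ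

theorem apply_eq_sum_component (f : LinForm K) {D : ℕ} {L : Idx} (hL : L.deg < D) :
    f (Finsupp.single L 1) = ∑ d ∈ range D, component f d (Finsupp.single L 1) := by
  simp_rw [component_single]
  rw [sum_ite_eq, if_pos (mem_range.2 hL)]

theorem shuffleSpan_le (d : ℕ) : shuffleSpan K n d ≤
    Submodule.span K (Set.range fun q : Idx × ℕ+ => shuffle K n q.1 q.2) :=
  Submodule.span_mono (Set.image_subset_range _ _)

theorem finsum_shuffle_eq_sum (hn : 1 ≤ n) (c : Idx × ℕ+ → K) (ω : Wedge K) :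
    ∑ᶠ q : Idx × ℕ+, c q * shuffle K n q.1 q.2 ω =
      ∑ q ∈ (finite_shuffle_ne_zero hn ω).toFinset, c q * shuffle K n q.1 q.2 ω := by
  refine finsum_eq_sum_of_support_subset _ fun q hq => ?_
  simp only [Function.mem_support, Set.Finite.coe_toFinset, Set.mem_ofPred_eq] at hq ⊢
  exact right_ne_zero_of_mul hq

theorem exists_coeff_of_mem_linearIdeal [IsAlgClosed K] (hn : 1 ≤ n) {f : LinForm K}
    (hf : f ∈ linearIdeal (affGr₀ K n)) :
    ∃ c : Idx × ℕ+ → K, ∀ ω : Wedge K,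
      f ω = ∑ᶠ q : Idx × ℕ+, c q * shuffle K n q.1 q.2 ω := by
  classical
  have h : ∀ d, ∃ l : Idx × ℕ+ →₀ K, (∀ q ∈ l.support, q.1.deg + n * (q.2 : ℕ) = d) ∧
      l.sum (fun q a => a • shuffle K n q.1 q.2) = component f d := by
    intro d
    obtain ⟨l, hl, he⟩ := (Finsupp.mem_span_image_iff_linearCombination K).1
      (component_mem_shuffleSpan hn hf d)
    exact ⟨l, fun q hq => (Finsupp.mem_supported K l).1 hl hq, he⟩
  choose l hl he using h
  -- Each pair `(I, ℓ)` belongs to the single degree `deg I + nℓ`, so the finite combinations chosen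
  -- in each degree glue to one family.
  refine ⟨fun q => l (q.1.deg + n * (q.2 : ℕ)) q, fun ω => ?_⟩
  set c : Idx × ℕ+ → K := fun q => l (q.1.deg + n * (q.2 : ℕ)) q with hc
  have hsingle : ∀ L : Idx, f (Finsupp.single L 1) =
      ∑ᶠ q : Idx × ℕ+, c q * shuffle K n q.1 q.2 (Finsupp.single L 1) := by
    intro L
    have h1 := component_single f L.deg L
    rw [if_pos rfl] at h1
    rw [← h1, ← he, Finsupp.sum, LinearMap.sum_apply]
    rw [finsum_eq_sum_of_support_subset (s := (l L.deg).support)]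
    · refine sum_congr rfl fun q hq => ?_
      simp only [hc, hl _ q hq]
      rfl
    · intro q hq
      rw [Function.mem_support] at hq
      have hd := deg_eq_of_shuffle hn (right_ne_zero_of_mul hq)
      have := left_ne_zero_of_mul hq
      simp only [hc, ← hd] at this
      exact Finsupp.mem_support_iff.2 this
  have hf' : f ω = ∑ L ∈ ω.support, ω L * f (Finsupp.single L 1) := by
    conv_lhs => rw [← ω.sum_single, Finsupp.sum, map_sum]
    refine sum_congr rfl fun L _ => ?_
    rw [← smul_eq_mul, ← map_smul, Finsupp.smul_single, smul_eq_mul, mul_one]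
  have hs : ∀ q : Idx × ℕ+, c q * shuffle K n q.1 q.2 ω = ∑ L ∈ ω.support,
      ω L * (c q * shuffle K n q.1 q.2 (Finsupp.single L 1)) := by
    intro q
    conv_lhs => rw [← ω.sum_single, Finsupp.sum, map_sum, mul_sum]
    refine sum_congr rfl fun L _ => ?_
    rw [mul_left_comm, ← smul_eq_mul (ω L), ← map_smul, Finsupp.smul_single, smul_eq_mul, mul_one]
  rw [hf']
  simp_rw [hs, hsingle]
  rw [finsum_sum_comm]
  · refine sum_congr rfl fun L _ => ?_
    rw [mul_finsum]
  · intro L _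
    exact (finite_shuffle_ne_zero hn (Finsupp.single L (1 : K))).subset fun q hq =>
      right_ne_zero_of_mul (right_ne_zero_of_mul hq)

theorem mem_linearIdeal_of_coeff (hn : 1 ≤ n) {f : LinForm K} {c : Idx × ℕ+ → K}
    (hc : ∀ ω : Wedge K, f ω = ∑ᶠ q : Idx × ℕ+, c q * shuffle K n q.1 q.2 ω) :
    f ∈ linearIdeal (affGr₀ K n) := by
  intro V hV ω hω
  rw [hc, finsum_shuffle_eq_sum hn]
  refine sum_eq_zero fun q _ => ?_
  rw [shuffle_mem_linearIdeal hn q.1 q.2 V hV ω hω, mul_zero]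

/-! ### Finite linear relations -/

theorem exists_apply_eq_zero_of_mem_span_plucker {f : LinForm K}
    (hf : f ∈ Submodule.span K (Set.range (plucker K))) :
    ∃ D : ℕ, ∀ L : Idx, D ≤ L.deg → f (Finsupp.single L 1) = 0 := by
  classical
  induction hf using Submodule.span_induction with
  | mem f hf =>
    obtain ⟨I, rfl⟩ := hf
    refine ⟨I.deg + 1, fun L hL => ?_⟩
    rw [plucker_single, if_neg]
    rintro rfl
    omega
  | zero => exact ⟨0, fun L _ => rfl⟩
  | add f g _ _ hf hg =>
    obtain ⟨D, hD⟩ := hf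
    obtain ⟨D', hD'⟩ := hg
    refine ⟨max D D', fun L hL => ?_⟩
    rw [LinearMap.add_apply, hD L (by omega), hD' L (by omega), add_zero]
  | smul a f _ hf =>
    obtain ⟨D, hD⟩ := hf
    exact ⟨D, fun L hL => by rw [LinearMap.smul_apply, hD L hL, smul_zero]⟩

theorem pluckerSeq_mem_span_plucker (k : ℕ → ℤ) :
    pluckerSeq K k ∈ Submodule.span K (Set.range (plucker K)) := by
  classical
  by_cases h : ∃ L : Idx, pluckerSeq K k (Finsupp.single L 1) ≠ 0
  · obtain ⟨L, hL⟩ := h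
    obtain ⟨-, hr⟩ := range_eq_of_pluckerSeq_ne_zero hL
    have : pluckerSeq K k = pluckerSeq K k (Finsupp.single L 1) • plucker K L := by
      refine LinForm.ext fun L' => ?_
      rw [LinearMap.smul_apply, plucker_single]
      by_cases hLL : L = L'
      · subst hLL
        simp
      · rw [if_neg hLL, smul_zero]
        by_contra hne
        exact hLL (Idx.eq_of_range_eq (hr.symm.trans (range_eq_of_pluckerSeq_ne_zero hne).2))
    rw [this]
    exact Submodule.smul_mem _ _ (Submodule.subset_span ⟨L, rfl⟩)
  · push Not at h
    have : pluckerSeq K k = 0 := LinForm.ext fun L => by rw [h]; rfl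
    rw [this]
    exact Submodule.zero_mem _

/-- A finite combination has non-zero components only below some degree `D`, and each component is
already a finite combination of shuffles. -/
theorem linearIdeal_inf_span_plucker [IsAlgClosed K] (hn : 1 ≤ n) :
    linearIdeal (affGr₀ K n) ⊓ Submodule.span K (Set.range (plucker K)) =
      Submodule.span K (Set.range fun q : Idx × ℕ+ => shuffle K n q.1 q.2) := by
  apply le_antisymm
  · rintro f ⟨hf, hfs⟩
    obtain ⟨D, hD⟩ := exists_apply_eq_zero_of_mem_span_plucker hfs
    have : f = ∑ d ∈ range D, component f d := by
      refine LinForm.ext fun L => ?_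
      rw [LinearMap.sum_apply]
      by_cases hL : L.deg < D
      · exact apply_eq_sum_component f hL
      · rw [hD L (by omega), sum_eq_zero]
        intro d hd
        have := mem_range.1 hd
        rw [component_single, if_neg (by omega)]
    rw [this]
    exact Submodule.sum_mem _ fun d _ => shuffleSpan_le d (component_mem_shuffleSpan hn hf d)
  · rw [Submodule.span_le]
    rintro _ ⟨q, rfl⟩
    refine ⟨shuffle_mem_linearIdeal hn q.1 q.2, ?_⟩
    change shuffle K n q.1 q.2 ∈ Submodule.span K (Set.range (plucker K))
    rw [shuffle_eq_sum hn q.1 q.2 le_rfl]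
    exact Submodule.sum_mem _ fun J _ => pluckerSeq_mem_span_plucker _

end AffGr

end

theorem theorem4p12 (K : Type*) [Field K] [IsAlgClosed K] (n : ℕ) (hn : 1 ≤ n) :
    -- no non-zero linear form vanishes on the infinite Grassmannian
    AffGr.linearIdeal (AffGr.infGr₀ K) = ⊥ ∧
    -- only finitely many shuffles involve a given Plücker coordinate
    (∀ ω : AffGr.Wedge K,
      {q : AffGr.Idx × ℕ+ | AffGr.shuffle K n q.1 q.2 ω ≠ 0}.Finite) ∧
    -- the degree-one part of the ideal consists of the combinations of the shuffles
    (∀ f : AffGr.LinForm K,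
      f ∈ AffGr.linearIdeal (AffGr.affGr₀ K n) ↔
        ∃ c : AffGr.Idx × ℕ+ → K, ∀ ω : AffGr.Wedge K,
          f ω = ∑ᶠ q : AffGr.Idx × ℕ+, c q * AffGr.shuffle K n q.1 q.2 ω) ∧
    -- the finite linear relations are the finite linear combinations of the shuffles
    AffGr.linearIdeal (AffGr.affGr₀ K n) ⊓ Submodule.span K (Set.range (AffGr.plucker K)) =
      Submodule.span K
        (Set.range fun q : AffGr.Idx × ℕ+ => AffGr.shuffle K n q.1 q.2) :=
  ⟨AffGr.linearIdeal_infGr₀, AffGr.finite_shuffle_ne_zero hn,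
    fun _ => ⟨AffGr.exists_coeff_of_mem_linearIdeal hn, fun ⟨_, hc⟩ =>
      AffGr.mem_linearIdeal_of_coeff hn hc⟩,
    AffGr.linearIdeal_inf_span_plucker hn⟩
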